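/- Let $(X,\mathcal B,\mu)$ be a $\sigma$-finite measure space and let $H$ be a reproducing kernel Hilbert space over $X$ (a Hilbert space of functions $X\to\mathbb C$ with continuous point evaluations) which is also a closed subspace of $L^2(X,\mu)$, i.e. every $f\in H$ is square integrable and $\|f\|_H=\|f\|_{L^2(\mu)}$. Assume that for every $x\in X$ some $f\in H$ has $f(x)\neq 0$ (for instance, that $1\in H$). Let $\mathcal A$ be a dual algebra of multipliers on $H$: a unital, weak-$*$ closed subalgebra of $B(H)$ all of whose elements are multiplication operators $M_\phi f=\phi f$ by functions $\phi$ on $X$; we write $\phi\in\mathcal A$ for $M_\phi\in\mathcal A$. For $f\in H$ and $\nu=|f|^2\mu$ let $\mathcal A^2(\nu)$ be the closure of $\mathcal A$ in $L^2(X,\nu)$. For $x\in X$ let $k^\nu_x\in\mathcal A^2(\nu)$ be the vector with $\langle\phi,k^\nu_x\rangle_{L^2(\nu)}=\phi(x)$ for all $\phi\in\mathcal A$ if evaluation at $x$ is bounded on $\mathcal A$ in the norm of $L^2(\nu)$, and $k^\nu_x=0$ otherwise. Put $k^\nu(x,y)=\langle k^\nu_y,k^\nu_x\rangle_{L^2(\nu)}$.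 Then for all $x_1,\dots,x_n\in X$ and $w_1,\dots,w_n\in\mathbb C$ the following are equivalent: (i) there is $\phi\in\mathcal A$ with $\sup_{x\in X}|\phi(x)|\le 1$ and $\phi(x_i)=w_i$ for $i=1,\dots,n$; (ii) the matrix $$\left[(1-w_i\overline{w_j})\,k^\nu(x_i,x_j)\right]_{i,j=1}^n$$ is positive semidefinite for every measure of the form $\nu=|f|^2\mu$ with $f\in H$. -/

import Mathlib

open MeasureTheory
open scoped Topology ENNReal ComplexConjugate ComplexOrder

noncomputable section

namespace PickDual

section Operators

variable {H : Type*} [NormedAddCommGroup H] [InnerProductSpace ℂ H]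

/-- Pairs `(u, v)` of square-summable sequences in `H`. Such a pair represents the trace class
operator `∑ₙ uₙ ⊗ vₙ`, and every trace class operator on a Hilbert space is of this form. -/
abbrev SqSummablePair (H : Type*) [NormedAddCommGroup H] : Type _ :=
  {p : (ℕ → H) × (ℕ → H) // Summable (fun n => ‖p.1 n‖ ^ 2) ∧ Summable (fun n => ‖p.2 n‖ ^ 2)}

/-- The weak-* (ultraweak) topology of `B(H)`, as the dual of the trace class operators: the
coarsest topology for which all functionals `T ↦ ∑ₙ ⟨T uₙ, vₙ⟩` are continuous
(Mathlib's inner product is linear in its second variable). -/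
abbrev weakStarTopology (H : Type*) [NormedAddCommGroup H] [InnerProductSpace ℂ H] :
    TopologicalSpace (H →L[ℂ] H) :=
  TopologicalSpace.induced
    (fun (T : H →L[ℂ] H) (p : SqSummablePair H) => ∑' n, inner ℂ (p.1.2 n) (T (p.1.1 n)))
    inferInstance

/-- A dual algebra: a unital subalgebra of `B(H)` that is closed in the weak-* topology. -/
def IsDualAlgebra (A : Subalgebra ℂ (H →L[ℂ] H)) : Prop :=
  IsClosed[weakStarTopology H] (A : Set (H →L[ℂ] H))

end Operators

section Multipliers

variable {X H : Type*} [NormedAddCommGroup H] [InnerProductSpace ℂ H] [RKHS ℂ H X ℂ]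

/-- `T` is the operator `M_φ` of multiplication by the function `φ` on `X`. -/
def IsMulOp (T : H →L[ℂ] H) (φ : X → ℂ) : Prop :=
  ∀ (f : H) (x : X), T f x = φ x * f x

/-- The multiplier algebra `M(H)`: all multiplication operators on `H`. -/
def multiplierAlgebra (H : Type*) {X : Type*} [NormedAddCommGroup H] [InnerProductSpace ℂ H]
    [RKHS ℂ H X ℂ] : Set (H →L[ℂ] H) :=
  {T | ∃ φ : X → ℂ, IsMulOp T φ}

/-- A dual algebra of multipliers: a dual algebra contained in `M(H)`. -/
structure IsDualAlgebraOfMultipliers (A : Subalgebra ℂ (H →L[ℂ] H)) : Prop where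
  isDualAlgebra : IsDualAlgebra A
  subset_multipliers : (A : Set (H →L[ℂ] H)) ⊆ multiplierAlgebra H

/-- The functions `φ` on `X` with `M_φ ∈ A`, that is, `A` regarded as a set of functions. -/
def symbols (A : Subalgebra ℂ (H →L[ℂ] H)) : Set (X → ℂ) :=
  {φ | ∃ T ∈ A, IsMulOp T φ}

end Multipliers

section Kernels

variable {X : Type*} [MeasurableSpace X]

/-- For a set `S` of functions on `X`, the closure in `L²(X, ν)` of the subspace spanned by those
members of `S` that are square integrable. For `S` the functions of an algebra of multipliers
and `ν = |f|²μ` this is the space `A²(ν)`. -/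
def closureL2 (S : Set (X → ℂ)) (ν : Measure X) : Submodule ℂ (Lp ℂ 2 ν) :=
  (Submodule.span ℂ {g | ∃ φ ∈ S, ∃ h : MemLp φ 2 ν, h.toLp φ = g}).topologicalClosure

/-- `k` is the reproducing kernel of the space `closureL2 S ν` at `x`:
it lies in that space and `φ x = ⟨φ, k⟩` for every `φ` in `S`. -/
def IsReproducingAt (S : Set (X → ℂ)) (ν : Measure X) (x : X) (k : Lp ℂ 2 ν) : Prop :=
  k ∈ closureL2 S ν ∧ ∀ φ ∈ S, ∀ h : MemLp φ 2 ν, inner ℂ k (h.toLp φ) = φ x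

open Classical in
/-- The reproducing kernel `k_x^ν` at `x`. It is set to `0` at the points `x` at which evaluation
is not bounded in the norm of `L²(ν)`, where no reproducing kernel exists. -/
def kernelVec (S : Set (X → ℂ)) (ν : Measure X) (x : X) : Lp ℂ 2 ν :=
  if h : ∃ k, IsReproducingAt S ν x k then h.choose else 0

/-- The kernel function `k^ν(x, y) = ⟨k_y^ν, k_x^ν⟩` (linear in `k_y^ν`). -/
def kernelFn (S : Set (X → ℂ)) (ν : Measure X) (x y : X) : ℂ :=
  inner ℂ (kernelVec S ν x) (kernelVec S ν y)

/-- The measure `|f|²μ`. -/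
def absSqMeasure (f : X → ℂ) (μ : Measure X) : Measure X :=
  μ.withDensity (fun x => ‖f x‖ₑ ^ 2)

/-- The reproducing kernel Hilbert space `H` of functions on `X` is a closed subspace of
`L²(X, μ)`: its members are square integrable and its norm is the norm of `L²(X, μ)`
(the image in `L²(X, μ)` is closed when `H` is complete). -/
def IsSubspaceL2 (H : Type*) [NormedAddCommGroup H] [InnerProductSpace ℂ H] [RKHS ℂ H X ℂ]
    (μ : Measure X) : Prop :=
  ∀ f : H, MemLp (f : X → ℂ) 2 μ ∧ eLpNorm (f : X → ℂ) 2 μ = ‖f‖ₑ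

end Kernels

end PickDual

end

/-!
By the Hahn-Banach theorem it suffices to bound `|∑ cᵢ wᵢ|` by the norm of the functional
`φ ↦ ∑ cᵢ φ(xᵢ)` on `A`. Suppose that this functional has the form `T ↦ ⟨g, T f⟩` with `‖f‖ ‖g‖`
close to its norm and `f(xᵢ) ≠ 0`. Then evaluation at `xᵢ` is bounded in `L²(|f|²μ)`, and positivity
of the Pick matrix for `|f|²μ` gives the bound, up to the error in the norm.

Idempotents of `A` split `X` into components, which can be treated one at a time. If all members
of `A` are constant on a component, the factorization is immediate. Otherwise a maximum principle
holds there: a function `φ` in `A` with `‖φ‖ ≤ 1` that is not constant on the component satisfies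
`|φ| < 1` throughout it, so its powers tend to zero pointwise. Hence the norms of operators are
almost attained at escaping vectors `φᴺ w`, which are almost orthogonal to any given finite set.
By duality, a functional `L` in the predual is then approximated by sums `∑ ⟨vⱼ, T uⱼ⟩` over
escaping vectors `uⱼ`. A choice of random signs, controlled by fourth moments, merges the sum into
one vector functional whose subtraction shrinks the residual of `L` by a fixed factor and has
negligible cross terms with the vectors already chosen. Iterating this gives the factorization.
-/

noncomputable section

namespace PickDual

open Filter

section Predual

lemma mem_closure_of_forall_sum_eq_zero {ι 𝕜 : Type*} [Field 𝕜] [TopologicalSpace 𝕜]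
    {W : Submodule 𝕜 (ι → 𝕜)} {y : ι → 𝕜}
    (h : ∀ (s : Finset ι) (c : s → 𝕜), (∀ w ∈ W, ∑ i, c i * w i = 0) → ∑ i, c i * y i = 0) :
    y ∈ closure (W : Set (ι → 𝕜)) := by
  classical
  rw [mem_closure_iff_nhds]
  intro t ht
  rw [nhds_pi, mem_pi'] at ht
  obtain ⟨s, u, hu, hut⟩ := ht
  let restrict : (ι → 𝕜) →ₗ[𝕜] (s → 𝕜) := LinearMap.funLeft 𝕜 𝕜 Subtype.val
  have hy : restrict y ∈ W.map restrict := by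
    by_contra hnot
    obtain ⟨c, hcy, hcW⟩ := Submodule.exists_le_ker_of_notMem hnot
    have hc : ∀ v : ι → 𝕜,
        c (restrict v) = ∑ i, c (fun j => if i = j then 1 else 0) * v i := fun v => by
      rw [LinearMap.pi_apply_eq_sum_univ]
      exact Finset.sum_congr rfl fun i _ => mul_comm _ _
    refine hcy ((hc y).trans (h s _ fun w hw => ?_))
    rw [← hc w]
    exact hcW (Submodule.mem_map_of_mem hw)
  obtain ⟨w, hw, hwy⟩ := hy
  refine ⟨w, hut fun i hi => ?_, hw⟩
  rw [show w i = y i from congrFun hwy ⟨i, hi⟩]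
  exact mem_of_mem_nhds (hu i)

variable {H : Type*} [NormedAddCommGroup H] [InnerProductSpace ℂ H]

/-- The operators in `A` as a normed algebra. This is a type synonym because the topology and the
additive structure that `↥A` inherits from `B(H)` do not unify with those underlying its norm. -/
def OpAlgebra (A : Subalgebra ℂ (H →L[ℂ] H)) : Type _ := A

variable (A : Subalgebra ℂ (H →L[ℂ] H))

instance : NormedRing (OpAlgebra A) := inferInstanceAs (NormedRing A)

instance : NormedAlgebra ℂ (OpAlgebra A) := inferInstanceAs (NormedAlgebra ℂ A)

/-- The inclusion of `A` into `B(H)`. -/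
def OpAlgebra.op : OpAlgebra A →ₐ[ℂ] (H →L[ℂ] H) := A.val

instance : CoeFun (OpAlgebra A) fun _ => H → H := ⟨fun T => OpAlgebra.op A T⟩

variable {A} in
lemma OpAlgebra.norm_apply_le (T : OpAlgebra A) (f : H) : ‖T f‖ ≤ ‖T‖ * ‖f‖ :=
  (OpAlgebra.op A T).le_opNorm f

/-- The vector functional `T ↦ ⟨g, T f⟩` on the algebra `A`, antilinear in `g` and linear in `f`. -/
def vectorFunctional : H →L⋆[ℂ] H →L[ℂ] StrongDual ℂ (OpAlgebra A) :=
  let opL : OpAlgebra A →L[ℂ] (H →L[ℂ] H) :=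
    (OpAlgebra.op A).toLinearMap.mkContinuous 1 fun T => (one_mul ‖T‖).ge
  ((ContinuousLinearMap.compL ℂ H (OpAlgebra A →L[ℂ] H) (StrongDual ℂ (OpAlgebra A))).flip
    opL.flip).comp ((ContinuousLinearMap.compL ℂ (OpAlgebra A) H ℂ).comp (innerSL ℂ))

@[simp]
lemma vectorFunctional_apply (g f : H) (T : OpAlgebra A) :
    vectorFunctional A g f T = inner ℂ g (T f) := rfl

lemma norm_vectorFunctional_le (g f : H) : ‖vectorFunctional A g f‖ ≤ ‖g‖ * ‖f‖ := by
  refine ContinuousLinearMap.opNorm_le_bound _ (by positivity) fun T => ?_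
  calc ‖inner ℂ g (T f)‖ ≤ ‖g‖ * ‖T f‖ := norm_inner_le_norm _ _
    _ ≤ ‖g‖ * (‖T‖ * ‖f‖) := by gcongr; exact T.norm_apply_le f
    _ = ‖g‖ * ‖f‖ * ‖T‖ := by ring

/-- The predual of `A`: the norm closed span of the vector functionals. -/
def predual : Submodule ℂ (StrongDual ℂ (OpAlgebra A)) :=
  (Submodule.span ℂ {R | ∃ g f : H, vectorFunctional A g f = R}).topologicalClosure

lemma vectorFunctional_mem_predual (g f : H) : vectorFunctional A g f ∈ predual A :=
  Submodule.le_topologicalClosure _ (Submodule.subset_span ⟨g, f, rfl⟩)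

lemma exists_operator_of_bidual [CompleteSpace H] (ξ : StrongDual ℂ (StrongDual ℂ (OpAlgebra A))) :
    ∃ T : H →L[ℂ] H, ∀ g f, ξ (vectorFunctional A g f) = inner ℂ g (T f) := by
  let B : H →L⋆[ℂ] H →L[ℂ] ℂ :=
    (ContinuousLinearMap.compL ℂ H (StrongDual ℂ (OpAlgebra A)) ℂ ξ).comp (vectorFunctional A)
  refine ⟨(InnerProductSpace.continuousLinearMapOfBilin B).adjoint, fun g f => ?_⟩
  rw [ContinuousLinearMap.adjoint_inner_right,
    InnerProductSpace.continuousLinearMapOfBilin_apply]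
  rfl

lemma SqSummablePair.summable_vectorFunctional (p : SqSummablePair H) :
    Summable fun n => vectorFunctional A (p.1.2 n) (p.1.1 n) := by
  refine Summable.of_norm_bounded (p.2.2.add p.2.1) fun n =>
    (norm_vectorFunctional_le A _ _).trans ?_
  nlinarith [two_mul_le_add_sq ‖p.1.2 n‖ ‖p.1.1 n‖, sq_nonneg ‖p.1.2 n‖, sq_nonneg ‖p.1.1 n‖]

/-- The functional on `A` given by the trace class operator that the pair `p` represents. -/
def traceFunctional (p : SqSummablePair H) : StrongDual ℂ (OpAlgebra A) :=
  ∑' n, vectorFunctional A (p.1.2 n) (p.1.1 n)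

lemma map_traceFunctional (ξ : StrongDual ℂ (StrongDual ℂ (OpAlgebra A))) (p : SqSummablePair H) :
    ξ (traceFunctional A p) = ∑' n, ξ (vectorFunctional A (p.1.2 n) (p.1.1 n)) :=
  ξ.map_tsum (p.summable_vectorFunctional A)

lemma traceFunctional_apply (p : SqSummablePair H) (T : OpAlgebra A) :
    traceFunctional A p T = ∑' n, inner ℂ (p.1.2 n) (T (p.1.1 n)) :=
  map_traceFunctional A (ContinuousLinearMap.apply ℂ ℂ T) p

variable {A}

lemma IsDualAlgebra.mem_of_forall_sum_eq_zero (hA : IsDualAlgebra A) {T : H →L[ℂ] H}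
    (hT : ∀ (s : Finset (SqSummablePair H)) (c : s → ℂ), ∑ p, c p • traceFunctional A p = 0 →
      ∑ p : s, c p * ∑' n, inner ℂ (p.1.1.2 n) (T (p.1.1.1 n)) = 0) : T ∈ A := by
  let Θ : (H →L[ℂ] H) → SqSummablePair H → ℂ :=
    fun T p => ∑' n, inner ℂ (p.1.2 n) (T (p.1.1 n))
  let W : Submodule ℂ (SqSummablePair H → ℂ) :=
    LinearMap.range (LinearMap.pi fun p => (traceFunctional A p).toLinearMap)
  have hW : (W : Set (SqSummablePair H → ℂ)) ⊆ Θ '' A := by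
    rintro _ ⟨S, rfl⟩
    exact ⟨OpAlgebra.op A S, S.2, funext fun p => (traceFunctional_apply A p S).symm⟩
  have hTW : Θ T ∈ closure (W : Set (SqSummablePair H → ℂ)) := by
    refine mem_closure_of_forall_sum_eq_zero fun s c hc => hT s c ?_
    ext S
    simpa using hc _ ⟨S, rfl⟩
  have hTA : T ∈ Θ ⁻¹' closure (Θ '' A) := closure_mono hW hTW
  let _ : TopologicalSpace (H →L[ℂ] H) := weakStarTopology H
  have hΘ : Topology.IsInducing Θ := ⟨rfl⟩
  rwa [← hΘ.closure_eq_preimage_closure_image, IsClosed.closure_eq hA] at hTA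

lemma exists_forall_predual_eq_apply [CompleteSpace H] (hA : IsDualAlgebra A)
    (ξ : StrongDual ℂ (StrongDual ℂ (OpAlgebra A))) :
    ∃ T : OpAlgebra A, ∀ R ∈ predual A, ξ R = R T := by
  obtain ⟨T, hT⟩ := exists_operator_of_bidual A ξ
  have hTA : T ∈ A := hA.mem_of_forall_sum_eq_zero fun s c hc => by
    simpa [map_traceFunctional, hT] using congrArg ξ hc
  let T' : OpAlgebra A := ⟨T, hTA⟩
  refine ⟨T', fun R hR => ?_⟩
  have hle : predual A ≤
      LinearMap.eqLocus ξ.toLinearMap (ContinuousLinearMap.apply ℂ ℂ T').toLinearMap := by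
    refine Submodule.topologicalClosure_minimal _ (Submodule.span_le.2 ?_)
      (isClosed_eq ξ.continuous (ContinuousLinearMap.continuous _))
    rintro _ ⟨g, f, rfl⟩
    exact hT g f
  exact hle hR

end Predual

section WeakConvergence

variable {E : Type*} [NormedAddCommGroup E] [InnerProductSpace ℂ E]

lemma sum_norm_inner_add_sq_le {κ : Type*} [Fintype κ] (u : κ → E) (v w : E) :
    ∑ j, ‖inner ℂ (v + w) (u j)‖ ^ 2 ≤
      2 * ∑ j, ‖inner ℂ v (u j)‖ ^ 2 + 2 * ∑ j, ‖inner ℂ w (u j)‖ ^ 2 := by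
  rw [← mul_add, ← Finset.sum_add_distrib, Finset.mul_sum]
  refine Finset.sum_le_sum fun j _ => ?_
  rw [inner_add_left]
  exact (pow_le_pow_left₀ (norm_nonneg _) (norm_add_le _ _) 2).trans (add_sq_le.trans (by simp))

lemma sum_norm_inner_sq_le {κ : Type*} [Fintype κ] (u : κ → E) (v : E) :
    ∑ j, ‖inner ℂ v (u j)‖ ^ 2 ≤ ‖v‖ ^ 2 * ∑ j, ‖u j‖ ^ 2 := by
  rw [Finset.mul_sum]
  refine Finset.sum_le_sum fun j _ => ?_
  rw [← mul_pow]
  exact pow_le_pow_left₀ (norm_nonneg _) (norm_inner_le_norm _ _) 2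

variable {ι : Type*} {l : Filter ι} {κ : ι → Type*} [∀ i, Fintype (κ i)]

/-- The vectors against which the families `u i` of vectors tend to zero along `l`. -/
def weakNullSpace (l : Filter ι) (u : ∀ i, κ i → E) : Submodule ℂ E where
  carrier := {v | Tendsto (fun i => ∑ j, ‖inner ℂ v (u i j)‖ ^ 2) l (𝓝 0)}
  zero_mem' := by simpa using tendsto_const_nhds
  add_mem' {v w} hv hw := squeeze_zero (fun i => by positivity)
    (fun i => sum_norm_inner_add_sq_le (u i) v w) <| by
      simpa using (hv.const_mul 2).add (hw.const_mul 2)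
  smul_mem' c v hv := by
    simpa [inner_smul_left, mul_pow, Finset.mul_sum, mul_comm] using hv.const_mul (‖c‖ ^ 2)

lemma isClosed_weakNullSpace {u : ∀ i, κ i → E} {C : ℝ} (hu : ∀ i, ∑ j, ‖u i j‖ ^ 2 ≤ C) :
    IsClosed (weakNullSpace l u : Set E) := by
  refine isClosed_of_closure_subset fun v hv => Metric.tendsto_nhds.2 fun ε hε => ?_
  have hnear : ∀ᶠ w in 𝓝 v, 2 * (‖v - w‖ ^ 2 * C) < ε / 2 := by
    have : Tendsto (fun w => 2 * (‖v - w‖ ^ 2 * C)) (𝓝 v) (𝓝 (2 * (‖v - v‖ ^ 2 * C))) :=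
      Continuous.tendsto (by fun_prop) v
    exact this.eventually_lt_const (by simpa using half_pos hε)
  obtain ⟨w, hvw, hw⟩ := mem_closure_iff_nhds.1 hv _ hnear
  filter_upwards [Metric.tendsto_nhds.1 hw (ε / 4) (by positivity)] with i hi
  rw [Real.dist_0_eq_abs, abs_of_nonneg (by positivity)] at hi ⊢
  have hsplit := sum_norm_inner_add_sq_le (u i) w (v - w)
  have hrest : ∑ j, ‖inner ℂ (v - w) (u i j)‖ ^ 2 ≤ ‖v - w‖ ^ 2 * C :=
    (sum_norm_inner_sq_le (u i) (v - w)).trans (by gcongr; exact hu i)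
  rw [add_sub_cancel] at hsplit
  have hvw : 2 * (‖v - w‖ ^ 2 * C) < ε / 2 := hvw
  linarith

lemma weakNullSpace_eq_top [CompleteSpace E] {u : ∀ i, κ i → E} {C : ℝ}
    (hu : ∀ i, ∑ j, ‖u i j‖ ^ 2 ≤ C) {S : Set E}
    (huS : ∀ i j, u i j ∈ (Submodule.span ℂ S).topologicalClosure)
    (hS : ∀ v ∈ S, Tendsto (fun i => ∑ j, ‖inner ℂ v (u i j)‖ ^ 2) l (𝓝 0)) :
    weakNullSpace l u = ⊤ := by
  let K := (Submodule.span ℂ S).topologicalClosure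
  have : CompleteSpace K :=
    (Submodule.isClosed_topologicalClosure _).completeSpace_coe
  have hK : K ≤ weakNullSpace l u :=
    Submodule.topologicalClosure_minimal _ (Submodule.span_le.2 hS) (isClosed_weakNullSpace hu)
  have hKperp : Kᗮ ≤ weakNullSpace l u := fun v hv => by
    have hvu : ∀ i j, inner ℂ v (u i j) = 0 := fun i j =>
      Submodule.inner_left_of_mem_orthogonal (huS i j) hv
    change Tendsto (fun i => ∑ j, ‖inner ℂ v (u i j)‖ ^ 2) l (𝓝 0)
    simpa [hvu] using tendsto_const_nhds
  exact top_unique (K.sup_orthogonal_of_hasOrthogonalProjection.ge.trans (sup_le hK hKperp))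

end WeakConvergence

section MulOp

variable {X H : Type*} [NormedAddCommGroup H] [InnerProductSpace ℂ H] [RKHS ℂ H X ℂ]

lemma IsMulOp.mul {S T : H →L[ℂ] H} {φ ψ : X → ℂ} (hS : IsMulOp S φ) (hT : IsMulOp T ψ) :
    IsMulOp (S * T) (φ * ψ) := fun f x => by
  rw [mul_apply_eq_comp, hS, hT, Pi.mul_apply, mul_assoc]

lemma IsMulOp.add {S T : H →L[ℂ] H} {φ ψ : X → ℂ} (hS : IsMulOp S φ) (hT : IsMulOp T ψ) :
    IsMulOp (S + T) (φ + ψ) := fun f x => by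
  simp [hS f x, hT f x, add_mul]

lemma isMulOp_algebraMap (c : ℂ) :
    IsMulOp (algebraMap ℂ (H →L[ℂ] H) c) (algebraMap ℂ (X → ℂ) c) := fun f x => by
  simp [Algebra.algebraMap_eq_smul_one]

/-- The set `symbols A` as an algebra of functions on `X`. -/
def symbolAlgebra (A : Subalgebra ℂ (H →L[ℂ] H)) : Subalgebra ℂ (X → ℂ) where
  carrier := symbols A
  mul_mem' := fun ⟨S, hS, hSφ⟩ ⟨T, hT, hTψ⟩ => ⟨S * T, mul_mem hS hT, hSφ.mul hTψ⟩
  add_mem' := fun ⟨S, hS, hSφ⟩ ⟨T, hT, hTψ⟩ => ⟨S + T, add_mem hS hT, hSφ.add hTψ⟩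
  algebraMap_mem' c := ⟨algebraMap ℂ _ c, A.algebraMap_mem c, isMulOp_algebraMap c⟩

variable [CompleteSpace H]

/-- The reproducing kernel of `H` at `x`, as a vector of `H`. -/
def evalVec (H : Type*) {X : Type*} [NormedAddCommGroup H] [InnerProductSpace ℂ H]
    [CompleteSpace H] [RKHS ℂ H X ℂ] (x : X) : H :=
  RKHS.kerFun H x (1 : ℂ)

@[simp]
lemma inner_evalVec (x : X) (f : H) : inner ℂ (evalVec H x) f = f x := by
  simp [evalVec]

lemma topologicalClosure_span_range_evalVec :
    (Submodule.span ℂ (Set.range (evalVec H (X := X)))).topologicalClosure = ⊤ := by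
  refine top_unique ((RKHS.kerFun_dense H).ge.trans (Submodule.topologicalClosure_mono ?_))
  refine Submodule.span_le.2 ?_
  rintro _ ⟨x, v, rfl⟩
  have hv : RKHS.kerFun H x v = v • evalVec H x := by
    rw [evalVec, ← map_smul, smul_eq_mul, mul_one]
  rw [hv]
  exact Submodule.smul_mem _ v (Submodule.subset_span ⟨x, rfl⟩)

variable {A : Subalgebra ℂ (H →L[ℂ] H)}

/-- The Berezin symbol of `T`: if `T` is the operator of multiplication by `φ`, this is `φ`
(and `0` at the points where all members of `H` vanish). -/
def symbol (T : OpAlgebra A) (x : X) : ℂ :=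
  inner ℂ (evalVec H x) (T (evalVec H x)) / (‖evalVec H x‖ : ℂ) ^ 2

lemma IsMulOp.apply_eq_symbol_mul {T : OpAlgebra A} {φ : X → ℂ}
    (hT : IsMulOp (OpAlgebra.op A T) φ) (f : H) (x : X) : T f x = symbol T x * f x := by
  rcases eq_or_ne (evalVec H x) 0 with hx | hx
  · have hzero : ∀ g : H, g x = 0 := fun g => by rw [← inner_evalVec, hx, inner_zero_left]
    rw [hzero, hzero, mul_zero]
  · have hself : evalVec H x x = (‖evalVec H x‖ : ℂ) ^ 2 := by
      rw [← inner_evalVec, inner_self_eq_norm_sq_to_K]; rfl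
    have hsymbol : symbol T x = φ x := by
      rw [symbol, inner_evalVec, hT, hself, mul_div_cancel_right₀]
      simpa using hx
    rw [hT, hsymbol]

lemma apply_eq_symbol_mul (hM : (A : Set (H →L[ℂ] H)) ⊆ multiplierAlgebra H)
    (T : OpAlgebra A) (f : H) (x : X) : T f x = symbol T x * f x :=
  let ⟨_, hφ⟩ := hM T.2
  hφ.apply_eq_symbol_mul f x

lemma symbol_mem_symbols (hM : (A : Set (H →L[ℂ] H)) ⊆ multiplierAlgebra H)
    (T : OpAlgebra A) : symbol T ∈ symbols A :=
  ⟨OpAlgebra.op A T, T.2, apply_eq_symbol_mul hM T⟩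

lemma symbol_mul_apply (hM : (A : Set (H →L[ℂ] H)) ⊆ multiplierAlgebra H)
    (S T : OpAlgebra A) (x : X) : symbol (S * T) x = symbol S x * symbol T x := by
  have h : (S * T) (evalVec H x) = S (T (evalVec H x)) := by simp
  rw [symbol, h, inner_evalVec, apply_eq_symbol_mul hM S, mul_div_assoc, symbol, symbol,
    inner_evalVec, inner_evalVec]

lemma symbol_eq_of_isMulOp (hH : ∀ x : X, ∃ f : H, f x ≠ 0) {T : OpAlgebra A}
    {φ : X → ℂ} (hT : IsMulOp (OpAlgebra.op A T) φ) : symbol T = φ := funext fun x => by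
  obtain ⟨f, hf⟩ := hH x
  exact mul_right_cancel₀ hf ((hT.apply_eq_symbol_mul f x).symm.trans (hT f x))

lemma symbol_one (hH : ∀ x : X, ∃ f : H, f x ≠ 0) : symbol (1 : OpAlgebra A) = (1 : X → ℂ) :=
  symbol_eq_of_isMulOp hH fun f x => by simp

lemma exists_symbol_eq (hH : ∀ x : X, ∃ f : H, f x ≠ 0) {φ : X → ℂ}
    (hφ : φ ∈ symbols A) : ∃ T : OpAlgebra A, symbol T = φ := by
  obtain ⟨T, hT, hTφ⟩ := hφ
  exact ⟨⟨T, hT⟩, symbol_eq_of_isMulOp hH hTφ⟩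

lemma norm_symbol_le (T : OpAlgebra A) (x : X) : ‖symbol T x‖ ≤ ‖T‖ := by
  rw [symbol, norm_div, norm_pow, Complex.norm_real, norm_norm]
  refine div_le_of_le_mul₀ (by positivity) (norm_nonneg T) ?_
  calc ‖inner ℂ (evalVec H x) (T (evalVec H x))‖ ≤ ‖evalVec H x‖ * ‖T (evalVec H x)‖ :=
        norm_inner_le_norm _ _
    _ ≤ ‖evalVec H x‖ * (‖T‖ * ‖evalVec H x‖) := by gcongr; exact T.norm_apply_le _
    _ = ‖T‖ * ‖evalVec H x‖ ^ 2 := by ring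

/-- The functional `T ↦ symbol T x` on `A`. -/
def evalFunctional (A : Subalgebra ℂ (H →L[ℂ] H)) (x : X) : StrongDual ℂ (OpAlgebra A) :=
  ((‖evalVec H x‖ : ℂ) ^ 2)⁻¹ • vectorFunctional A (evalVec H x) (evalVec H x)

@[simp]
lemma evalFunctional_apply (x : X) (T : OpAlgebra A) : evalFunctional A x T = symbol T x :=
  inv_mul_eq_div _ _

lemma evalFunctional_mem_predual (x : X) : evalFunctional A x ∈ predual A :=
  Submodule.smul_mem _ _ (vectorFunctional_mem_predual A _ _)

lemma norm_evalFunctional (hH : ∀ x : X, ∃ f : H, f x ≠ 0) (x : X) :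
    ‖evalFunctional A x‖ = 1 := by
  refine le_antisymm (ContinuousLinearMap.opNorm_le_bound _ zero_le_one fun T => ?_) ?_
  · simpa using norm_symbol_le T x
  · calc 1 = ‖evalFunctional A x 1‖ := by simp [symbol_one hH]
      _ ≤ ‖evalFunctional A x‖ * ‖(1 : OpAlgebra A)‖ := (evalFunctional A x).le_opNorm 1
      _ ≤ ‖evalFunctional A x‖ :=
        mul_le_of_le_one_right (norm_nonneg _) ContinuousLinearMap.norm_id_le

end MulOp

section L2

variable {X H : Type*} [MeasurableSpace X] {μ : Measure X} [NormedAddCommGroup H]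
  [InnerProductSpace ℂ H] [RKHS ℂ H X ℂ]

lemma IsSubspaceL2.memLp (hL2 : IsSubspaceL2 H μ) (f : H) : MemLp (f : X → ℂ) 2 μ := (hL2 f).1

/-- The inclusion of `H` into `L²(μ)`. -/
def IsSubspaceL2.toL2 (hL2 : IsSubspaceL2 H μ) : H →ₗᵢ[ℂ] Lp ℂ 2 μ where
  toFun f := (hL2.memLp f).toLp f
  map_add' f g := by
    rw [← MemLp.toLp_add]; exact MemLp.toLp_congr _ _ (by simp)
  map_smul' c f := by
    rw [RingHom.id_apply, ← MemLp.toLp_const_smul]; exact MemLp.toLp_congr _ _ (by simp)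
  norm_map' f := by
    change ‖(hL2.memLp f).toLp f‖ = ‖f‖
    rw [Lp.norm_toLp, (hL2 f).2, toReal_enorm]

lemma IsSubspaceL2.inner_toL2_ae_eq (hL2 : IsSubspaceL2 H μ) (f g : H) :
    (fun x => inner ℂ (hL2.toL2 f x) (hL2.toL2 g x)) =ᵐ[μ] fun x => conj (f x) * g x := by
  filter_upwards [(hL2.memLp f).coeFn_toLp, (hL2.memLp g).coeFn_toLp] with x hf hg
  change inner ℂ ((hL2.memLp f).toLp f x) ((hL2.memLp g).toLp g x) = _
  rw [hf, hg, RCLike.inner_apply, mul_comm]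

lemma IsSubspaceL2.inner_eq_integral (hL2 : IsSubspaceL2 H μ) (f g : H) :
    inner ℂ f g = ∫ x, conj (f x) * g x ∂μ := by
  rw [← hL2.toL2.inner_map_map f g, L2.inner_def]
  exact integral_congr_ae (hL2.inner_toL2_ae_eq f g)

lemma IsSubspaceL2.integrable_mul (hL2 : IsSubspaceL2 H μ) (f g : H) :
    Integrable (fun x => conj (f x) * g x) μ :=
  (L2.integrable_inner (𝕜 := ℂ) (hL2.toL2 f) (hL2.toL2 g)).congr (hL2.inner_toL2_ae_eq f g)

lemma IsSubspaceL2.integrable_norm_sq (hL2 : IsSubspaceL2 H μ) (f : H) :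
    Integrable (fun x => ‖f x‖ ^ 2) μ :=
  (memLp_two_iff_integrable_sq_norm (hL2.memLp f).1).1 (hL2.memLp f)

lemma IsSubspaceL2.integral_norm_sq (hL2 : IsSubspaceL2 H μ) (f : H) :
    ∫ x, ‖f x‖ ^ 2 ∂μ = ‖f‖ ^ 2 := by
  have h := hL2.inner_eq_integral f f
  simp_rw [Complex.conj_mul', ← Complex.ofReal_pow] at h
  rw [integral_complex_ofReal, inner_self_eq_norm_sq_to_K] at h
  exact Complex.ofReal_injective (h.symm.trans (Complex.ofReal_pow _ _).symm)

lemma IsSubspaceL2.norm_le_of_norm_apply_le (hL2 : IsSubspaceL2 H μ) {C : ℝ} (hC : 0 ≤ C)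
    {f g : H} (h : ∀ x, ‖f x‖ ≤ C * ‖g x‖) : ‖f‖ ≤ C * ‖g‖ := by
  refine le_of_sq_le_sq ?_ (by positivity)
  rw [mul_pow, ← hL2.integral_norm_sq f, ← hL2.integral_norm_sq g, ← integral_const_mul]
  refine integral_mono (hL2.integrable_norm_sq f) ((hL2.integrable_norm_sq g).const_mul _)
    fun x => ?_
  simpa only [mul_pow] using pow_le_pow_left₀ (norm_nonneg _) (h x) 2

lemma IsSubspaceL2.norm_le_of_norm_symbol_le [CompleteSpace H] (hL2 : IsSubspaceL2 H μ)
    {A : Subalgebra ℂ (H →L[ℂ] H)} (hM : (A : Set (H →L[ℂ] H)) ⊆ multiplierAlgebra H)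
    {T : OpAlgebra A} {C : ℝ} (hC : 0 ≤ C) (h : ∀ x, ‖symbol T x‖ ≤ C) : ‖T‖ ≤ C :=
  (OpAlgebra.op A T).opNorm_le_bound hC fun f => hL2.norm_le_of_norm_apply_le hC fun x => by
    rw [apply_eq_symbol_mul hM, norm_mul]; gcongr; exact h x

end L2

section Compactness

variable {X H : Type*} [MeasurableSpace X] {μ : Measure X} [NormedAddCommGroup H]
  [InnerProductSpace ℂ H] [CompleteSpace H] [RKHS ℂ H X ℂ] {A : Subalgebra ℂ (H →L[ℂ] H)}

/-- The functions in `A` that are bounded by `1` on `X`. -/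
def symbolBall (A : Subalgebra ℂ (H →L[ℂ] H)) : Set (X → ℂ) :=
  {φ ∈ symbols A | ∀ y, ‖φ y‖ ≤ 1}

lemma isCompact_symbolBall (hL2 : IsSubspaceL2 H μ) (hH : ∀ x : X, ∃ f : H, f x ≠ 0)
    (hA : IsDualAlgebraOfMultipliers A) : IsCompact (symbolBall A) := by
  have hM := hA.subset_multipliers
  let Φ : WeakDual ℂ (StrongDual ℂ (OpAlgebra A)) → X → ℂ := fun ξ y => ξ (evalFunctional A y)
  have hΦ : Continuous Φ := continuous_pi fun y => WeakDual.eval_continuous (evalFunctional A y)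
  convert (WeakDual.isCompact_closedBall (𝕜 := ℂ) (0 : StrongDual ℂ (StrongDual ℂ (OpAlgebra A)))
    1).image hΦ using 1
  refine Set.Subset.antisymm ?_ ?_
  · rintro φ ⟨hφ, hφ1⟩
    obtain ⟨T, rfl⟩ := exists_symbol_eq hH hφ
    refine ⟨StrongDual.toWeakDual (ContinuousLinearMap.apply ℂ ℂ T), ?_,
      funext fun y => evalFunctional_apply y T⟩
    rw [Set.mem_preimage, mem_closedBall_zero_iff]
    refine ContinuousLinearMap.opNorm_le_bound _ zero_le_one fun S => ?_
    calc ‖S T‖ ≤ ‖S‖ * ‖T‖ := S.le_opNorm T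
      _ ≤ ‖S‖ * 1 := by gcongr; exact hL2.norm_le_of_norm_symbol_le hM zero_le_one hφ1
      _ = 1 * ‖S‖ := mul_comm _ _
  · rintro _ ⟨ξ, hξ, rfl⟩
    rw [Set.mem_preimage, mem_closedBall_zero_iff] at hξ
    obtain ⟨T, hT⟩ :=
      exists_forall_predual_eq_apply hA.isDualAlgebra (WeakDual.toStrongDual ξ)
    have hΦT : Φ ξ = symbol T := funext fun y => by
      rw [← evalFunctional_apply, ← hT _ (evalFunctional_mem_predual y)]
      rfl
    refine ⟨hΦT ▸ symbol_mem_symbols hM T, fun y => ?_⟩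
    calc ‖ξ (evalFunctional A y)‖ ≤ 1 * 1 :=
          (WeakDual.toStrongDual ξ).le_of_opNorm_le_of_le hξ (norm_evalFunctional hH y).le
      _ = 1 := one_mul 1

lemma mem_symbolBall_of_tendsto (hL2 : IsSubspaceL2 H μ) (hH : ∀ x : X, ∃ f : H, f x ≠ 0)
    (hA : IsDualAlgebraOfMultipliers A) {ι : Type*} {l : Filter ι} [l.NeBot] {φ : ι → X → ℂ}
    (hφ : ∀ n, φ n ∈ symbolBall A) {ψ : X → ℂ}
    (h : ∀ x, Tendsto (fun n => φ n x) l (𝓝 (ψ x))) : ψ ∈ symbolBall A :=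
  (isCompact_symbolBall hL2 hH hA).isClosed.mem_of_tendsto (tendsto_pi_nhds.2 h) (.of_forall hφ)

end Compactness

section Components

variable {X H : Type*} [NormedAddCommGroup H] [InnerProductSpace ℂ H] [RKHS ℂ H X ℂ]
  {A : Subalgebra ℂ (H →L[ℂ] H)}

/-- The sets whose indicator function belongs to `A`. They play the role of the clopen sets in
the decomposition of `X` into components. -/
def IsClopenFor (A : Subalgebra ℂ (H →L[ℂ] H)) (E : Set X) : Prop :=
  E.indicator 1 ∈ symbolAlgebra A

/-- The component of `x`: the intersection of all sets containing `x` whose indicator function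
belongs to `A`. -/
def component (A : Subalgebra ℂ (H →L[ℂ] H)) (x : X) : Set X :=
  ⋂₀ {E | IsClopenFor A E ∧ x ∈ E}

lemma mem_component_self (A : Subalgebra ℂ (H →L[ℂ] H)) (x : X) : x ∈ component A x :=
  Set.mem_sInter.2 fun _ h => h.2

lemma component_subset {E : Set X} {x : X} (hE : IsClopenFor A E) (hx : x ∈ E) :
    component A x ⊆ E := Set.sInter_subset_of_mem ⟨hE, hx⟩

lemma isClopenFor_univ (A : Subalgebra ℂ (H →L[ℂ] H)) : IsClopenFor A (Set.univ : Set X) := by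
  rw [IsClopenFor, Set.indicator_univ]
  exact one_mem _

lemma IsClopenFor.inter {E F : Set X} (hE : IsClopenFor A E) (hF : IsClopenFor A F) :
    IsClopenFor A (E ∩ F) := by
  rw [IsClopenFor, Set.inter_indicator_one]
  exact mul_mem hE hF

lemma IsClopenFor.diff {E F : Set X} (hE : IsClopenFor A E) (hF : IsClopenFor A F) :
    IsClopenFor A (E \ F) := by
  have h : (E \ F).indicator (1 : X → ℂ) = E.indicator 1 - (E ∩ F).indicator 1 := by
    funext z
    by_cases hzE : z ∈ E <;> by_cases hzF : z ∈ F <;> simp [hzE, hzF]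
  rw [IsClopenFor, h]
  exact sub_mem hE (hE.inter hF)

lemma isClopenFor_biInter {ι : Type*} (s : Finset ι) {E : ι → Set X}
    (hE : ∀ i ∈ s, IsClopenFor A (E i)) : IsClopenFor A (⋂ i ∈ s, E i) := by
  classical
  induction s using Finset.induction_on with
  | empty => simpa using isClopenFor_univ A
  | insert i s _ ih =>
    rw [Finset.set_biInter_insert]
    exact (hE i (Finset.mem_insert_self i s)).inter
      (ih fun j hj => hE j (Finset.mem_insert_of_mem hj))

lemma IsClopenFor.indicator_mem_symbolBall {E : Set X} (hE : IsClopenFor A E) :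
    E.indicator 1 ∈ symbolBall A :=
  ⟨hE, fun y => by by_cases hy : y ∈ E <;> simp [hy]⟩

variable [MeasurableSpace X] {μ : Measure X} [CompleteSpace H]

lemma isClopenFor_component (hL2 : IsSubspaceL2 H μ) (hH : ∀ x : X, ∃ f : H, f x ≠ 0)
    (hA : IsDualAlgebraOfMultipliers A) (x : X) : IsClopenFor A (component A x) := by
  have hex : ∀ y, ∃ E, (IsClopenFor A E ∧ x ∈ E) ∧ (y ∈ E → y ∈ component A x) := fun y => by
    by_contra! h
    exact (h Set.univ ⟨isClopenFor_univ A, trivial⟩).2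
      (Set.mem_sInter.2 fun E hE => (h E hE).1)
  choose E hE hEx using hex
  let F : Finset X → Set X := fun s => ⋂ y ∈ s, E y
  have hF : ∀ s, IsClopenFor A (F s) := fun s => isClopenFor_biInter s fun y _ => (hE y).1
  have hsub : ∀ s, component A x ⊆ F s := fun s =>
    component_subset (hF s) (Set.mem_iInter₂.2 fun y _ => (hE y).2)
  refine (mem_symbolBall_of_tendsto (l := atTop) hL2 hH hA
    (fun s => (hF s).indicator_mem_symbolBall) fun y => ?_).1
  refine tendsto_const_nhds.congr' ?_
  filter_upwards [eventually_ge_atTop {y}] with s hs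
  have hy : y ∈ F s ↔ y ∈ component A x :=
    ⟨fun h => hEx y (Set.mem_iInter₂.1 h y (Finset.singleton_subset_iff.1 hs)), fun h => hsub s h⟩
  classical
  simp only [Set.indicator_apply, hy]

lemma norm_one_add_half_lt_one {a : ℂ} (ha : ‖a‖ ≤ 1) (ha1 : a ≠ 1) : ‖(1 + a) / 2‖ < 1 := by
  have hlt : ‖(1 / 2 : ℝ) • (1 : ℂ) + (1 / 2 : ℝ) • a‖ < 1 :=
    norm_combo_lt_of_ne (by simp) ha ha1.symm (by norm_num) (by norm_num) (by norm_num)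
  convert hlt using 2
  push_cast [Complex.real_smul]
  ring

lemma isClopenFor_setOf_eq_one (hL2 : IsSubspaceL2 H μ) (hH : ∀ x : X, ∃ f : H, f x ≠ 0)
    (hA : IsDualAlgebraOfMultipliers A) {θ : X → ℂ} (hθ : θ ∈ symbolBall A) :
    IsClopenFor A {z | θ z = 1} := by
  let χ : X → ℂ := (1 / 2 : ℂ) • (1 + θ)
  have hχ : χ ∈ symbolAlgebra A := Subalgebra.smul_mem _ (add_mem (one_mem _) hθ.1) _
  have hχ_eq : ∀ z, χ z = (1 + θ z) / 2 := fun z => by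
    simp only [χ, Pi.smul_apply, Pi.add_apply, Pi.one_apply, smul_eq_mul]
    ring
  have hχ_lt : ∀ z, θ z ≠ 1 → ‖χ z‖ < 1 := fun z hz => by
    rw [hχ_eq]
    exact norm_one_add_half_lt_one (hθ.2 z) hz
  have hχ_one : ∀ z, θ z = 1 → χ z = 1 := fun z hz => by rw [hχ_eq, hz]; norm_num
  refine (mem_symbolBall_of_tendsto (l := atTop) hL2 hH hA
    (φ := fun n : ℕ => χ ^ n) (fun n => ⟨pow_mem hχ n, fun z => ?_⟩) fun z => ?_).1
  · rw [Pi.pow_apply, norm_pow]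
    refine pow_le_one₀ (norm_nonneg _) ?_
    by_cases hz : θ z = 1
    · simp [hχ_one z hz]
    · exact (hχ_lt z hz).le
  · by_cases hz : θ z = 1
    · simp [hz, hχ_one z hz]
    · simpa [hz] using tendsto_pow_atTop_nhds_zero_of_norm_lt_one (hχ_lt z hz)

lemma eq_of_norm_eq_one_of_mem_component (hL2 : IsSubspaceL2 H μ)
    (hH : ∀ x : X, ∃ f : H, f x ≠ 0) (hA : IsDualAlgebraOfMultipliers A) {x : X} {ψ : X → ℂ}
    (hψ : ψ ∈ symbols A) (hb : ∀ y ∈ component A x, ‖ψ y‖ ≤ 1) {y : X} (hy : y ∈ component A x)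
    (hy1 : ‖ψ y‖ = 1) {z : X} (hz : z ∈ component A x) : ψ z = ψ y := by
  have hE : IsClopenFor A (component A x) := isClopenFor_component hL2 hH hA x
  have hyy : conj (ψ y) * ψ y = 1 := by rw [Complex.conj_mul', hy1]; norm_num
  let θ : X → ℂ := (component A x).indicator 1 * conj (ψ y) • ψ
  have hθ_eq : ∀ z ∈ component A x, θ z = conj (ψ y) * ψ z := fun z hz => by simp [θ, hz]
  have hθ : θ ∈ symbolBall A := by
    refine ⟨mul_mem hE (Subalgebra.smul_mem (symbolAlgebra A) hψ _), fun z => ?_⟩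
    by_cases hz : z ∈ component A x
    · simpa [hθ_eq z hz, hy1] using hb z hz
    · simp [θ, hz]
  have hF := isClopenFor_setOf_eq_one hL2 hH hA hθ
  have hyF : θ y = 1 := by rw [hθ_eq y hy, hyy]
  have hxF : θ x = 1 := by
    by_contra hx
    exact (component_subset (hE.diff hF) ⟨mem_component_self A x, hx⟩ hy).2 hyF
  have hzF : θ z = 1 := component_subset hF hxF hz
  rw [hθ_eq z hz, ← hyy] at hzF
  exact mul_left_cancel₀ (left_ne_zero_of_mul_eq_one hyy) hzF

end Components

section Signs

variable {ι : Type*} [DecidableEq ι]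

/-- The sum of the `z j`, `j ∈ s`, with sign `+` for `j ∈ t` and `-` otherwise. -/
def signSum {M : Type*} [AddCommGroup M] (z : ι → M) (s t : Finset ι) : M :=
  ∑ j ∈ s, if j ∈ t then z j else -z j

lemma signSum_insert_of_notMem {M : Type*} [AddCommGroup M] (z : ι → M) {a : ι} {s t : Finset ι}
    (ha : a ∉ s) (ht : t ⊆ s) : signSum z (insert a s) t = signSum z s t - z a := by
  rw [signSum, Finset.sum_insert ha, if_neg fun h => ha (ht h), signSum]
  abel

lemma signSum_insert_insert {M : Type*} [AddCommGroup M] (z : ι → M) {a : ι} {s t : Finset ι}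
    (ha : a ∉ s) : signSum z (insert a s) (insert a t) = signSum z s t + z a := by
  rw [signSum, Finset.sum_insert ha, if_pos (Finset.mem_insert_self a t), signSum, add_comm]
  congr 1
  refine Finset.sum_congr rfl fun j hj => ?_
  have : j ≠ a := fun h => ha (h ▸ hj)
  simp [this]

variable {E : Type*} [NormedAddCommGroup E]

lemma norm_pow_four_sub_add_norm_pow_four_add_le [InnerProductSpace ℝ E] (u z : E) :
    ‖u - z‖ ^ 4 + ‖u + z‖ ^ 4 ≤ 2 * (‖u‖ ^ 4 + 6 * ‖u‖ ^ 2 * ‖z‖ ^ 2 + ‖z‖ ^ 4) := by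
  have h1 : ‖u - z‖ ^ 2 + ‖u + z‖ ^ 2 = 2 * (‖u‖ ^ 2 + ‖z‖ ^ 2) := by
    linarith [parallelogram_law_with_norm ℝ u z]
  have h2 : ‖u + z‖ ^ 2 - ‖u - z‖ ^ 2 = 4 * (inner ℝ u z) := by
    rw [norm_add_sq_real, norm_sub_sq_real]; ring
  have h3 : (inner ℝ u z) ^ 2 ≤ ‖u‖ ^ 2 * ‖z‖ ^ 2 := by
    rw [← mul_pow, ← sq_abs]
    exact pow_le_pow_left₀ (abs_nonneg _) (abs_real_inner_le_norm u z) 2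
  have h4 : ‖u - z‖ ^ 4 + ‖u + z‖ ^ 4 =
      ((‖u - z‖ ^ 2 + ‖u + z‖ ^ 2) ^ 2 + (‖u + z‖ ^ 2 - ‖u - z‖ ^ 2) ^ 2) / 2 := by ring
  rw [h4, h1, h2]
  nlinarith

lemma sum_norm_sq_signSum (𝕜 : Type*) [RCLike 𝕜] [InnerProductSpace 𝕜 E] (z : ι → E)
    (s : Finset ι) :
    ∑ t ∈ s.powerset, ‖signSum z s t‖ ^ 2 = 2 ^ s.card * ∑ j ∈ s, ‖z j‖ ^ 2 := by
  induction s using Finset.induction_on with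
  | empty => simp [signSum]
  | insert a s ha ih =>
    rw [Finset.sum_powerset_insert ha, ← Finset.sum_add_distrib, Finset.card_insert_of_notMem ha,
      Finset.sum_insert ha]
    have : ∀ t ∈ s.powerset, ‖signSum z (insert a s) t‖ ^ 2 +
        ‖signSum z (insert a s) (insert a t)‖ ^ 2 = 2 * (‖signSum z s t‖ ^ 2 + ‖z a‖ ^ 2) := by
      intro t ht
      rw [signSum_insert_of_notMem z ha (Finset.mem_powerset.1 ht), signSum_insert_insert z ha]
      linarith [parallelogram_law_with_norm 𝕜 (signSum z s t) (z a)]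
    rw [Finset.sum_congr rfl this, ← Finset.mul_sum, Finset.sum_add_distrib, ih,
      Finset.sum_const, Finset.card_powerset, nsmul_eq_mul]
    push_cast
    ring

lemma sum_norm_pow_four_signSum_le [InnerProductSpace ℝ E] (z : ι → E) (s : Finset ι) :
    ∑ t ∈ s.powerset, ‖signSum z s t‖ ^ 4 ≤ 3 * 2 ^ s.card * (∑ j ∈ s, ‖z j‖ ^ 2) ^ 2 := by
  induction s using Finset.induction_on with
  | empty => simp [signSum]
  | insert a s ha ih =>
    rw [Finset.sum_powerset_insert ha, ← Finset.sum_add_distrib, Finset.card_insert_of_notMem ha,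
      Finset.sum_insert ha]
    have : ∀ t ∈ s.powerset, ‖signSum z (insert a s) t‖ ^ 4 +
        ‖signSum z (insert a s) (insert a t)‖ ^ 4 ≤
        2 * (‖signSum z s t‖ ^ 4 + ‖signSum z s t‖ ^ 2 * (6 * ‖z a‖ ^ 2) + ‖z a‖ ^ 4) := by
      intro t ht
      rw [signSum_insert_of_notMem z ha (Finset.mem_powerset.1 ht), signSum_insert_insert z ha]
      refine (norm_pow_four_sub_add_norm_pow_four_add_le _ _).trans (le_of_eq ?_)
      ring
    refine (Finset.sum_le_sum this).trans ?_
    rw [← Finset.mul_sum, Finset.sum_add_distrib, Finset.sum_add_distrib, ← Finset.sum_mul,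
      sum_norm_sq_signSum ℝ, Finset.sum_const, Finset.card_powerset, nsmul_eq_mul]
    push_cast
    have hN : (0 : ℝ) < 2 ^ s.card := by positivity
    set P := ∑ j ∈ s, ‖z j‖ ^ 2
    have hb : 0 ≤ ‖z a‖ ^ 4 := by positivity
    have hNb := mul_nonneg hN.le hb
    rw [pow_succ' (2 : ℝ) s.card]
    nlinarith

lemma sum_norm_signSum_le [InnerProductSpace ℝ E] (z : ι → E) (s : Finset ι) :
    ∑ t ∈ s.powerset, ‖signSum z s t‖ ≤ 2 ^ s.card * √(∑ j ∈ s, ‖z j‖ ^ 2) := by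
  have hP : 0 ≤ ∑ j ∈ s, ‖z j‖ ^ 2 := Finset.sum_nonneg fun _ _ => by positivity
  refine le_of_sq_le_sq ?_ (by positivity)
  refine (sq_sum_le_card_mul_sum_sq (s := s.powerset)).trans (le_of_eq ?_)
  rw [sum_norm_sq_signSum ℝ, mul_pow, Real.sq_sqrt hP, Finset.card_powerset]
  push_cast
  ring

lemma sum_abs_sub_norm_sq_signSum_le [InnerProductSpace ℝ E] (z : ι → E) (s : Finset ι) (l : ℝ) :
    ∑ t ∈ s.powerset, |∑ j ∈ s, ‖z j‖ ^ 2 - l * ‖signSum z s t‖ ^ 2| ≤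
      2 ^ s.card * ((1 - l + 3 / 2 * l ^ 2) * ∑ j ∈ s, ‖z j‖ ^ 2) := by
  set P := ∑ j ∈ s, ‖z j‖ ^ 2 with hPdef
  have hP : 0 ≤ P := Finset.sum_nonneg fun _ _ => by positivity
  have h2 := sum_norm_sq_signSum ℝ z s
  have h4 := sum_norm_pow_four_signSum_le z s
  rw [← hPdef] at h2 h4
  have hpt : ∀ a : ℝ, |P - l * a| * P ≤ P ^ 2 - P * l * a + l ^ 2 / 2 * a ^ 2 := by
    intro a
    rcases abs_cases (P - l * a) with ⟨h, _⟩ | ⟨h, _⟩ <;> rw [h] <;>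
      nlinarith [sq_nonneg (2 * P - l * a), sq_nonneg (l * a)]
  rcases hP.eq_or_lt with h0 | hpos
  · rw [← h0] at h2 ⊢
    have hz : ∀ t ∈ s.powerset, ‖signSum z s t‖ ^ 2 = 0 :=
      (Finset.sum_eq_zero_iff_of_nonneg fun _ _ => by positivity).1 (by rw [h2, mul_zero])
    rw [Finset.sum_eq_zero fun t ht => by rw [hz t ht]; simp]
    simp
  · refine le_of_mul_le_mul_right ?_ hpos
    rw [Finset.sum_mul]
    refine (Finset.sum_le_sum fun t _ => hpt (‖signSum z s t‖ ^ 2)).trans ?_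
    rw [Finset.sum_add_distrib, Finset.sum_sub_distrib, ← Finset.mul_sum, ← Finset.mul_sum, h2,
      Finset.sum_const, Finset.card_powerset, nsmul_eq_mul]
    have h4' : ∑ t ∈ s.powerset, (‖signSum z s t‖ ^ 2) ^ 2 ≤ 3 * 2 ^ s.card * P ^ 2 := by
      refine le_trans (le_of_eq (Finset.sum_congr rfl fun t _ => by ring)) h4
    push_cast
    have : l ^ 2 / 2 * ∑ t ∈ s.powerset, (‖signSum z s t‖ ^ 2) ^ 2 ≤
        l ^ 2 / 2 * (3 * 2 ^ s.card * P ^ 2) := by gcongr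
    linarith

end Signs

section SignSelection

variable {X H : Type*} [NormedAddCommGroup H] [InnerProductSpace ℂ H] [RKHS ℂ H X ℂ]
  {ι : Type*}

lemma coe_sum_apply (U : ι → H) (s : Finset ι) (x : X) : (∑ j ∈ s, U j) x = ∑ j ∈ s, U j x := by
  classical
  induction s using Finset.induction_on with
  | empty => simp
  | insert a s ha ih => simp [Finset.sum_insert ha, ih]

lemma signSum_apply [DecidableEq ι] (U : ι → H) (s t : Finset ι) (x : X) :
    (signSum U s t) x = signSum (fun j => U j x) s t := by
  rw [signSum, coe_sum_apply, signSum]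
  refine Finset.sum_congr rfl fun j _ => ?_
  split_ifs <;> simp

variable [MeasurableSpace X] {μ : Measure X} [Fintype ι]

lemma IsSubspaceL2.integrable_sum_norm_sq (hL2 : IsSubspaceL2 H μ) (U : ι → H) :
    Integrable (fun x => ∑ j, ‖U j x‖ ^ 2) μ :=
  integrable_finsetSum _ fun j _ => hL2.integrable_norm_sq (U j)

lemma IsSubspaceL2.integral_sum_norm_sq (hL2 : IsSubspaceL2 H μ) (U : ι → H) :
    ∫ x, ∑ j, ‖U j x‖ ^ 2 ∂μ = ∑ j, ‖U j‖ ^ 2 := by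
  rw [integral_finsetSum _ fun j _ => hL2.integrable_norm_sq (U j)]
  exact Finset.sum_congr rfl fun j _ => hL2.integral_norm_sq (U j)

lemma IsSubspaceL2.memLp_sqrt_sum_norm_sq (hL2 : IsSubspaceL2 H μ) (U : ι → H) :
    MemLp (fun x => √(∑ j, ‖U j x‖ ^ 2)) 2 μ := by
  have hm : AEStronglyMeasurable (fun x => √(∑ j, ‖U j x‖ ^ 2)) μ :=
    Real.continuous_sqrt.comp_aestronglyMeasurable (hL2.integrable_sum_norm_sq U).1
  rw [memLp_two_iff_integrable_sq_norm hm]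
  refine (hL2.integrable_sum_norm_sq U).congr (.of_forall fun x => ?_)
  simp only [Real.norm_eq_abs, sq_abs]
  rw [Real.sq_sqrt (Finset.sum_nonneg fun _ _ => by positivity)]

variable [DecidableEq ι]

lemma IsSubspaceL2.integrable_abs_sub_norm_sq_signSum (hL2 : IsSubspaceL2 H μ) (U : ι → H) (l : ℝ)
    (s t : Finset ι) : Integrable (fun x => |∑ j, ‖U j x‖ ^ 2 - l * ‖signSum U s t x‖ ^ 2|) μ :=
  ((hL2.integrable_sum_norm_sq U).sub ((hL2.integrable_norm_sq _).const_mul l)).abs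

lemma IsSubspaceL2.sum_integral_abs_sub_norm_sq_signSum_le (hL2 : IsSubspaceL2 H μ) (U : ι → H)
    (l : ℝ) :
    ∑ t ∈ Finset.univ.powerset,
        ∫ x, |∑ j, ‖U j x‖ ^ 2 - l * ‖signSum U Finset.univ t x‖ ^ 2| ∂μ ≤
      2 ^ Fintype.card ι * ((1 - l + 3 / 2 * l ^ 2) * ∑ j, ‖U j‖ ^ 2) := by
  have hi := hL2.integrable_abs_sub_norm_sq_signSum U l Finset.univ
  rw [← integral_finsetSum _ fun t _ => hi t, ← hL2.integral_sum_norm_sq U,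
    ← integral_const_mul, ← integral_const_mul]
  refine integral_mono (integrable_finsetSum _ fun t _ => hi t)
    (((hL2.integrable_sum_norm_sq U).const_mul _).const_mul _) fun x => ?_
  simpa only [signSum_apply, Finset.card_univ] using
    sum_abs_sub_norm_sq_signSum_le (fun j => U j x) Finset.univ l

lemma IsSubspaceL2.sum_integral_norm_signSum_mul_le (hL2 : IsSubspaceL2 H μ) (U : ι → H)
    {F : X → ℝ} (hF : MemLp F 2 μ) (hF0 : ∀ x, 0 ≤ F x) :
    ∑ t ∈ Finset.univ.powerset, ∫ x, ‖signSum U Finset.univ t x‖ * F x ∂μ ≤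
      2 ^ Fintype.card ι * ∫ x, √(∑ j, ‖U j x‖ ^ 2) * F x ∂μ := by
  have hi : ∀ t, Integrable (fun x => ‖signSum U Finset.univ t x‖ * F x) μ := fun t =>
    (hL2.memLp _).norm.integrable_mul hF
  rw [← integral_finsetSum _ fun t _ => hi t, ← integral_const_mul]
  refine integral_mono (integrable_finsetSum _ fun t _ => hi t)
    (((hL2.memLp_sqrt_sum_norm_sq U).integrable_mul hF).const_mul _) fun x => ?_
  simp only [signSum_apply]
  rw [← Finset.sum_mul, ← mul_assoc]
  exact mul_le_mul_of_nonneg_right (sum_norm_signSum_le (fun j => U j x) Finset.univ) (hF0 x)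

lemma IsSubspaceL2.exists_signSum (hL2 : IsSubspaceL2 H μ) (U : ι → H) {F : X → ℝ}
    (hF : MemLp F 2 μ) (hF0 : ∀ x, 0 ≤ F x) {l η D : ℝ} (hD : 0 ≤ D) :
    ∃ t : Finset ι,
      ∫ x, |∑ j, ‖U j x‖ ^ 2 - l * ‖signSum U Finset.univ t x‖ ^ 2| ∂μ +
        (1 - η) * (l * ‖signSum U Finset.univ t‖ ^ 2) +
        D * ∫ x, ‖signSum U Finset.univ t x‖ * F x ∂μ ≤
      (1 - η * l + 3 / 2 * l ^ 2) * ∑ j, ‖U j‖ ^ 2 +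
        D * ∫ x, √(∑ j, ‖U j x‖ ^ 2) * F x ∂μ := by
  suffices h : ∃ t ∈ (Finset.univ : Finset ι).powerset, _ by
    obtain ⟨t, -, ht⟩ := h
    exact ⟨t, ht⟩
  refine Finset.exists_le_of_sum_le ⟨∅, Finset.empty_mem_powerset _⟩ ?_
  have h₁ := hL2.sum_integral_abs_sub_norm_sq_signSum_le U l
  have h₂ := sum_norm_sq_signSum ℂ U Finset.univ
  have h₃ := mul_le_mul_of_nonneg_left (hL2.sum_integral_norm_signSum_mul_le U hF hF0) hD
  rw [Finset.card_univ] at h₂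
  rw [Finset.sum_const, nsmul_eq_mul, Finset.card_powerset, Finset.card_univ,
    Finset.sum_add_distrib, Finset.sum_add_distrib, ← Finset.mul_sum, ← Finset.mul_sum,
    ← Finset.mul_sum, h₂]
  push_cast
  linarith

end SignSelection

section Escape

lemma mul_le_min_mul_add_sq_div {a b c : ℝ} (ha : 0 ≤ a) (hb : 0 ≤ b) (hc : 0 < c) :
    a * b ≤ min a (c * b) * b + a ^ 2 / c := by
  rcases le_total a (c * b) with h | h
  · rw [min_eq_left h]
    exact le_add_of_nonneg_right (by positivity)
  · have hab : a * b ≤ a ^ 2 / c := by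
      rw [le_div_iff₀ hc, sq, mul_assoc, mul_comm b]
      gcongr
    rw [min_eq_right h]
    exact hab.trans (le_add_of_nonneg_left (by positivity))

variable {X : Type*} [MeasurableSpace X] {μ : Measure X}

lemma tendsto_integral_min_mul {F : X → ℝ} (hF : MemLp F 2 μ) (hF0 : ∀ x, 0 ≤ F x)
    {g : ℕ → X → ℝ} (hg : ∀ n, AEStronglyMeasurable (g n) μ) (hg0 : ∀ n x, 0 ≤ g n x)
    (hlim : ∀ x, Tendsto (fun n => g n x) atTop (𝓝 0)) {c : ℝ} (hc : 0 ≤ c) :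
    (∀ n, Integrable (fun x => min (g n x) (c * F x) * F x) μ) ∧
      Tendsto (fun n => ∫ x, min (g n x) (c * F x) * F x ∂μ) atTop (𝓝 0) := by
  have hm : ∀ n, AEStronglyMeasurable (fun x => min (g n x) (c * F x) * F x) μ := fun n =>
    ((hg n).inf (hF.1.const_mul c)).mul hF.1
  have hbd : ∀ n, ∀ᵐ x ∂μ, ‖min (g n x) (c * F x) * F x‖ ≤ c * F x ^ 2 := fun n =>
    .of_forall fun x => by
      have h0 : 0 ≤ min (g n x) (c * F x) := le_min (hg0 n x) (mul_nonneg hc (hF0 x))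
      rw [Real.norm_of_nonneg (mul_nonneg h0 (hF0 x)), sq, ← mul_assoc]
      exact mul_le_mul_of_nonneg_right (min_le_right _ _) (hF0 x)
  have hi : Integrable (fun x => c * F x ^ 2) μ := hF.integrable_sq.const_mul c
  refine ⟨fun n => hi.mono' (hm n) (hbd n), ?_⟩
  have hpt : ∀ x, Tendsto (fun n => min (g n x) (c * F x) * F x) atTop (𝓝 0) := fun x => by
    simpa [min_eq_left (mul_nonneg hc (hF0 x))] using
      ((hlim x).min (tendsto_const_nhds (x := c * F x))).mul_const (F x)
  simpa using tendsto_integral_of_dominated_convergence _ hm hi hbd (.of_forall hpt)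

lemma tendsto_integral_mul_of_tendsto_zero {F : X → ℝ} (hF : MemLp F 2 μ) (hF0 : ∀ x, 0 ≤ F x)
    {g : ℕ → X → ℝ} (hg : ∀ n, MemLp (g n) 2 μ) (hg0 : ∀ n x, 0 ≤ g n x) {C : ℝ}
    (hC : ∀ n, ∫ x, g n x ^ 2 ∂μ ≤ C) (hlim : ∀ x, Tendsto (fun n => g n x) atTop (𝓝 0)) :
    Tendsto (fun n => ∫ x, g n x * F x ∂μ) atTop (𝓝 0) := by
  have hC0 : 0 ≤ C := (integral_nonneg fun x => sq_nonneg (g 0 x)).trans (hC 0)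
  refine Metric.tendsto_nhds.2 fun ε hε => ?_
  let c : ℝ := 2 * (C + 1) / ε
  have hc : 0 < c := by positivity
  obtain ⟨hi, hmin⟩ := tendsto_integral_min_mul hF hF0 (fun n => (hg n).1) hg0 hlim hc.le
  filter_upwards [hmin.eventually_lt_const (half_pos hε)] with n hn
  have hi' : Integrable (fun x => g n x ^ 2 / c) μ := (hg n).integrable_sq.div_const c
  have hle : ∫ x, g n x * F x ∂μ ≤
      ∫ x, min (g n x) (c * F x) * F x ∂μ + ∫ x, g n x ^ 2 / c ∂μ := by
    rw [← integral_add (hi n) hi']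
    exact integral_mono ((hg n).integrable_mul hF) ((hi n).add hi') fun x =>
      mul_le_min_mul_add_sq_div (hg0 n x) (hF0 x) hc
  have htail : ∫ x, g n x ^ 2 / c ∂μ ≤ ε / 2 := by
    rw [integral_div, div_le_iff₀ hc]
    have : ε / 2 * c = C + 1 := by simp only [c]; field_simp
    linarith [hC n]
  rw [dist_zero_right, Real.norm_of_nonneg
    (integral_nonneg fun x => mul_nonneg (hg0 n x) (hF0 x))]
  linarith

variable {H : Type*} [NormedAddCommGroup H] [InnerProductSpace ℂ H] [RKHS ℂ H X ℂ]
  [CompleteSpace H]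

lemma IsSubspaceL2.tendsto_integral_sqrt_mul (hL2 : IsSubspaceL2 H μ) {κ : ℕ → Type*}
    [∀ n, Fintype (κ n)] {U : ∀ n, κ n → H} {C : ℝ} (hU : ∀ n, ∑ j, ‖U n j‖ ^ 2 ≤ C)
    (hnull : weakNullSpace atTop U = ⊤) {F : X → ℝ} (hF : MemLp F 2 μ) (hF0 : ∀ x, 0 ≤ F x) :
    Tendsto (fun n => ∫ x, √(∑ j, ‖U n j x‖ ^ 2) * F x ∂μ) atTop (𝓝 0) := by
  refine tendsto_integral_mul_of_tendsto_zero (C := C) hF hF0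
    (fun n => hL2.memLp_sqrt_sum_norm_sq (U n)) (fun n x => Real.sqrt_nonneg _) (fun n => ?_)
    fun x => ?_
  · have hsq : ∀ x, √(∑ j, ‖U n j x‖ ^ 2) ^ 2 = ∑ j, ‖U n j x‖ ^ 2 := fun x =>
      Real.sq_sqrt (Finset.sum_nonneg fun _ _ => by positivity)
    simp_rw [hsq, hL2.integral_sum_norm_sq]
    exact hU n
  · have hx : evalVec H x ∈ weakNullSpace atTop U := hnull ▸ Submodule.mem_top
    have hsum : Tendsto (fun n => ∑ j, ‖U n j x‖ ^ 2) atTop (𝓝 0) := by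
      simpa only [inner_evalVec] using (show Tendsto _ _ _ from hx)
    simpa using hsum.sqrt

/-- `U` has total mass at most `1` and is orthogonal to the vectors of `s` up to `δ`. -/
def IsEscaping {ι : Type*} [Fintype ι] (s : Finset H) (δ : ℝ) (U : ι → H) : Prop :=
  ∑ j, ‖U j‖ ^ 2 ≤ 1 ∧ ∀ e ∈ s, ∑ j, ‖inner ℂ e (U j)‖ ^ 2 ≤ δ

lemma IsSubspaceL2.exists_forall_integral_sqrt_mul_le (hL2 : IsSubspaceL2 H μ) {F : X → ℝ}
    (hF : MemLp F 2 μ) (hF0 : ∀ x, 0 ≤ F x) {ε : ℝ} (hε : 0 < ε) :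
    ∃ s : Finset H, ∃ δ > 0, ∀ (ι : Type) [Fintype ι] (U : ι → H), IsEscaping s δ U →
      ∫ x, √(∑ j, ‖U j x‖ ^ 2) * F x ∂μ ≤ ε := by
  classical
  by_contra! h
  choose κ hκ U hU hlt using fun s (n : ℕ) =>
    h s (1 / ((n : ℝ) + 1)) Nat.one_div_pos_of_nat
  -- Each bad family is tested against all the previous ones.
  let S : ℕ → Finset H := fun n => n.rec (∅ : Finset H) fun n s => s ∪ Finset.univ.image (U s n)
  have hS : Monotone S := monotone_nat_of_le_succ fun n => Finset.subset_union_left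
  have hnull : weakNullSpace atTop (fun n => U (S n) n) = ⊤ := by
    refine weakNullSpace_eq_top (S := ⋃ n : ℕ, {v | v ∈ S n}) (fun n => (hU (S n) n).1)
      (fun n j => ?_) fun v hv => ?_
    · refine Submodule.le_topologicalClosure _ (Submodule.subset_span ?_)
      exact Set.mem_iUnion.2 ⟨n + 1, Finset.mem_union_right _
        (Finset.mem_image_of_mem _ (Finset.mem_univ j))⟩
    · obtain ⟨m, hm⟩ := Set.mem_iUnion.1 hv
      refine squeeze_zero' (.of_forall fun n => by positivity) ?_
        (tendsto_one_div_add_atTop_nhds_zero_nat (𝕜 := ℝ))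
      filter_upwards [eventually_ge_atTop m] with n hn
      exact (hU (S n) n).2 v (hS hn hm)
  have hlim := hL2.tendsto_integral_sqrt_mul (fun n => (hU (S n) n).1) hnull hF hF0
  exact hε.not_ge (ge_of_tendsto' hlim fun n => (hlt (S n) n).le)

end Escape

section EscapingVectors

lemma exists_inner_eq_norm {E : Type*} [NormedAddCommGroup E] [InnerProductSpace ℂ E] (y : E) :
    ∃ v : E, ‖v‖ ≤ 1 ∧ inner ℂ v y = ‖y‖ := by
  refine ⟨(‖y‖⁻¹ : ℂ) • y, ?_, ?_⟩
  · simpa [norm_smul] using inv_mul_le_one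
  · rw [inner_smul_left, inner_self_eq_norm_sq_to_K]
    rcases eq_or_ne y 0 with rfl | hy
    · simp
    · have : (‖y‖ : ℂ) ≠ 0 := by simpa using hy
      simp only [map_inv₀, Complex.conj_ofReal, Complex.coe_algebraMap]
      field_simp

variable {X H : Type*} [NormedAddCommGroup H] [InnerProductSpace ℂ H] [RKHS ℂ H X ℂ]
  {A : Subalgebra ℂ (H →L[ℂ] H)} {E : Set X} {P : OpAlgebra A}

lemma pow_succ_apply (T : OpAlgebra A) (n : ℕ) (f : H) : (T ^ (n + 1)) f = T ((T ^ n) f) := by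
  simp [pow_succ']

variable [CompleteSpace H]

lemma symbol_pow_succ_apply (hM : (A : Set (H →L[ℂ] H)) ⊆ multiplierAlgebra H) (T : OpAlgebra A)
    (n : ℕ) (x : X) : symbol (T ^ (n + 1)) x = symbol T x ^ (n + 1) := by
  induction n with
  | zero => simp
  | succ n ih => rw [pow_succ T, symbol_mul_apply hM, ih, ← pow_succ]

lemma symbol_smul_apply (c : ℂ) (T : OpAlgebra A) (x : X) :
    symbol (c • T) x = c * symbol T x := by
  simp [symbol, mul_div_assoc]

/-- `P` is the operator of multiplication by the indicator function of `E`. -/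
def IsRestrictionTo (P : OpAlgebra A) (E : Set X) : Prop := symbol P = E.indicator 1

lemma IsRestrictionTo.symbol_mul_of_mem (hM : (A : Set (H →L[ℂ] H)) ⊆ multiplierAlgebra H)
    (hP : IsRestrictionTo P E) (T : OpAlgebra A) {x : X} (hx : x ∈ E) :
    symbol (P * T) x = symbol T x := by
  rw [symbol_mul_apply hM, hP, Set.indicator_of_mem hx, Pi.one_apply, one_mul]

lemma IsRestrictionTo.symbol_mul_of_notMem (hM : (A : Set (H →L[ℂ] H)) ⊆ multiplierAlgebra H)
    (hP : IsRestrictionTo P E) (T : OpAlgebra A) {x : X} (hx : x ∉ E) :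
    symbol (P * T) x = 0 := by
  rw [symbol_mul_apply hM, hP, Set.indicator_of_notMem hx, zero_mul]

lemma IsRestrictionTo.apply_mul_apply (hM : (A : Set (H →L[ℂ] H)) ⊆ multiplierAlgebra H)
    (hP : IsRestrictionTo P E) (T : OpAlgebra A) (f : H) : P ((P * T) f) = (P * T) f :=
  RKHS.ext fun x => by
    rw [apply_eq_symbol_mul hM, apply_eq_symbol_mul hM]
    by_cases hx : x ∈ E
    · rw [hP, Set.indicator_of_mem hx, Pi.one_apply, one_mul]
    · rw [hP.symbol_mul_of_notMem hM T hx, zero_mul, mul_zero]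

lemma IsRestrictionTo.apply_eq_zero (hM : (A : Set (H →L[ℂ] H)) ⊆ multiplierAlgebra H)
    (hP : IsRestrictionTo P E) {f : H} (hf : P f = f) {x : X} (hx : x ∉ E) : f x = 0 := by
  rw [← hf, apply_eq_symbol_mul hM, hP, Set.indicator_of_notMem hx, zero_mul]

lemma mul_apply_of_apply_eq (hM : (A : Set (H →L[ℂ] H)) ⊆ multiplierAlgebra H)
    (T : OpAlgebra A) {f : H} (hf : P f = f) : (P * T) f = T f :=
  RKHS.ext fun x => by
    nth_rw 2 [← hf]
    rw [apply_eq_symbol_mul hM, symbol_mul_apply hM, apply_eq_symbol_mul hM T,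
      apply_eq_symbol_mul hM P, ← mul_assoc, mul_comm (symbol P x)]

lemma weakNullSpace_pow_apply_eq_top (hM : (A : Set (H →L[ℂ] H)) ⊆ multiplierAlgebra H)
    {S : OpAlgebra A} (hS : ‖S‖ ≤ 1) (hlt : ∀ x, ‖symbol S x‖ < 1) {w : ℕ → H}
    (hw : ∀ n, ‖w n‖ ≤ 1) :
    weakNullSpace atTop (fun n (_ : Unit) => (S ^ (n + 1)) (w n)) = ⊤ := by
  have hu : ∀ n, ‖(S ^ (n + 1)) (w n)‖ ≤ 1 := fun n =>
    calc ‖(S ^ (n + 1)) (w n)‖ ≤ ‖S ^ (n + 1)‖ * ‖w n‖ := OpAlgebra.norm_apply_le _ _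
      _ ≤ ‖S‖ ^ (n + 1) * ‖w n‖ := by gcongr; exact norm_pow_le' S n.succ_pos
      _ ≤ 1 := mul_le_one₀ (pow_le_one₀ (norm_nonneg _) hS) (norm_nonneg _) (hw n)
  refine weakNullSpace_eq_top (C := 1) (S := Set.range (evalVec H (X := X)))
    (fun n => by simpa using hu n) (fun n _ => by simp [topologicalClosure_span_range_evalVec]) ?_
  rintro _ ⟨x, rfl⟩
  have hlim : Tendsto (fun n => ‖symbol S x‖ ^ (n + 1) * ‖evalVec H x‖) atTop (𝓝 0) := by
    simpa using ((tendsto_pow_atTop_nhds_zero_of_lt_one (norm_nonneg _) (hlt x)).comp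
      (tendsto_add_atTop_nat 1)).mul_const ‖evalVec H x‖
  have hpt : Tendsto (fun n => (S ^ (n + 1)) (w n) x) atTop (𝓝 0) := by
    refine squeeze_zero_norm (fun n => ?_) hlim
    rw [apply_eq_symbol_mul hM, symbol_pow_succ_apply hM, norm_mul, norm_pow]
    gcongr
    rw [← inner_evalVec]
    exact (norm_inner_le_norm _ _).trans (mul_le_of_le_one_right (norm_nonneg _) (hw n))
  simpa using hpt.norm.pow 2

variable [MeasurableSpace X] {μ : Measure X}

lemma IsSubspaceL2.norm_pow_succ (hL2 : IsSubspaceL2 H μ)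
    (hM : (A : Set (H →L[ℂ] H)) ⊆ multiplierAlgebra H) (T : OpAlgebra A) (n : ℕ) :
    ‖T ^ (n + 1)‖ = ‖T‖ ^ (n + 1) := by
  refine le_antisymm (norm_pow_le' T n.succ_pos) ?_
  have hT : ‖T‖ ≤ ‖T ^ (n + 1)‖ ^ ((n + 1 : ℕ) : ℝ)⁻¹ := by
    refine hL2.norm_le_of_norm_symbol_le hM (by positivity) fun x => ?_
    rw [← Real.pow_rpow_inv_natCast (norm_nonneg (symbol T x)) n.succ_ne_zero, ← norm_pow,
      ← symbol_pow_succ_apply hM]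
    gcongr
    exact norm_symbol_le _ x
  calc ‖T‖ ^ (n + 1) ≤ (‖T ^ (n + 1)‖ ^ ((n + 1 : ℕ) : ℝ)⁻¹) ^ (n + 1) := by gcongr
    _ = ‖T ^ (n + 1)‖ := Real.rpow_inv_natCast_pow (norm_nonneg _) n.succ_ne_zero

lemma IsSubspaceL2.exists_isEscaping_of_norm_eq_one (hL2 : IsSubspaceL2 H μ)
    (hM : (A : Set (H →L[ℂ] H)) ⊆ multiplierAlgebra H) {S : OpAlgebra A} (hS : ‖S‖ = 1)
    (hlt : ∀ x, ‖symbol S x‖ < 1) (s : Finset H) {δ : ℝ} (hδ : 0 < δ) {a : ℝ} (ha : a < 1) :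
    ∃ w : H, IsEscaping s δ (fun _ : Unit => S w) ∧ a < ‖S (S w)‖ := by
  have hpow : ∀ n, ‖S ^ (n + 1)‖ = 1 := fun n => by rw [hL2.norm_pow_succ hM, hS, one_pow]
  have hex : ∀ n : ℕ, ∃ w : H, ‖w‖ < 1 ∧ a < ‖(S ^ (n + 2)) w‖ := fun n =>
    ContinuousLinearMap.exists_lt_apply_of_lt_opNorm (OpAlgebra.op A (S ^ (n + 2)))
      (ha.trans_eq (hpow (n + 1)).symm)
  choose w hw haw using hex
  have hnull := weakNullSpace_pow_apply_eq_top hM hS.le hlt fun n => (hw n).le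
  have htest : ∀ᶠ n in atTop, ∀ e ∈ s, ‖inner ℂ e ((S ^ (n + 1)) (w n))‖ ^ 2 < δ := by
    refine (Filter.eventually_all_finset s).2 fun e _ => ?_
    have he : e ∈ weakNullSpace atTop (fun n (_ : Unit) => (S ^ (n + 1)) (w n)) :=
      hnull ▸ Submodule.mem_top
    simpa using (show Tendsto _ _ _ from he).eventually_lt_const hδ
  obtain ⟨n, hn⟩ := htest.exists
  refine ⟨(S ^ n) (w n), ?_, ?_⟩
  · rw [← pow_succ_apply]
    refine ⟨?_, fun e he => by simpa using (hn e he).le⟩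
    have hu : ‖(S ^ (n + 1)) (w n)‖ ≤ 1 :=
      (OpAlgebra.norm_apply_le _ _).trans (mul_le_one₀ (hpow n).le (norm_nonneg _) (hw n).le)
    simpa using hu
  · rw [← pow_succ_apply, ← pow_succ_apply]
    exact haw n

lemma IsSubspaceL2.exists_isEscaping_of_norm_symbol_lt (hL2 : IsSubspaceL2 H μ)
    (hM : (A : Set (H →L[ℂ] H)) ⊆ multiplierAlgebra H) {T : OpAlgebra A}
    (hT : ∀ x, ‖symbol T x‖ < ‖T‖) (s : Finset H) {δ : ℝ} (hδ : 0 < δ) {a : ℝ} (ha : a < 1) :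
    ∃ w : H, IsEscaping s δ (fun _ : Unit => T w) ∧ a * ‖T‖ ≤ ‖T (T w)‖ := by
  rcases eq_or_ne T 0 with rfl | hT0
  · exact ⟨0, by simp [IsEscaping, hδ.le], by simp⟩
  have hpos : 0 < ‖T‖ := norm_pos_iff.2 hT0
  let S : OpAlgebra A := (‖T‖⁻¹ : ℂ) • T
  have hS : ‖S‖ = 1 := norm_smul_inv_norm hT0
  have hlt : ∀ x, ‖symbol S x‖ < 1 := fun x => by
    rw [symbol_smul_apply, norm_mul, norm_inv, Complex.norm_real, norm_norm, inv_mul_lt_one₀ hpos]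
    exact hT x
  obtain ⟨w, hw, haw⟩ := hL2.exists_isEscaping_of_norm_eq_one hM hS hlt s hδ ha
  have hTw : T ((‖T‖⁻¹ : ℂ) • w) = S w := by simp [S]
  refine ⟨(‖T‖⁻¹ : ℂ) • w, by rwa [hTw], ?_⟩
  have hSS : ‖S (S w)‖ = ‖T‖⁻¹ * ‖T (S w)‖ := by
    rw [show S (S w) = (‖T‖⁻¹ : ℂ) • T (S w) by simp [S], norm_smul, norm_inv, Complex.norm_real,
      norm_norm]
  rw [hSS, lt_inv_mul_iff₀ hpos, mul_comm] at haw
  rw [hTw]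
  exact haw.le

/-- All functions in `A` are constant on the component of `x₀`. -/
def IsConstantOnComponent (A : Subalgebra ℂ (H →L[ℂ] H)) (x₀ : X) : Prop :=
  ∀ φ ∈ symbols A, ∀ z ∈ component A x₀, φ z = φ x₀

variable {x₀ : X}

lemma symbol_eq_of_norm_le_norm_symbol (hL2 : IsSubspaceL2 H μ) (hH : ∀ x : X, ∃ f : H, f x ≠ 0)
    (hA : IsDualAlgebraOfMultipliers A) (hP : IsRestrictionTo P (component A x₀))
    {T : OpAlgebra A} {y : X} (hy : ‖P * T‖ ≤ ‖symbol (P * T) y‖) {z : X}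
    (hz : z ∈ component A x₀) : symbol T z = symbol T x₀ := by
  have hM := hA.subset_multipliers
  have hle : ∀ z ∈ component A x₀, ‖symbol T z‖ ≤ ‖P * T‖ := fun z hz => by
    rw [← hP.symbol_mul_of_mem hM T hz]
    exact norm_symbol_le _ z
  rcases (norm_nonneg (P * T)).eq_or_lt with h0 | hpos
  · have hzero : ∀ z ∈ component A x₀, symbol T z = 0 := fun z hz =>
      norm_le_zero_iff.1 (h0 ▸ hle z hz)
    rw [hzero z hz, hzero x₀ (mem_component_self A x₀)]
  have hyx : y ∈ component A x₀ := by
    by_contra hyx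
    rw [hP.symbol_mul_of_notMem hM T hyx, norm_zero] at hy
    exact hpos.not_ge hy
  rw [hP.symbol_mul_of_mem hM T hyx] at hy
  have hc : (‖P * T‖⁻¹ : ℂ) ≠ 0 := inv_ne_zero (by exact_mod_cast hpos.ne')
  let S : OpAlgebra A := (‖P * T‖⁻¹ : ℂ) • T
  have hS : ∀ z, ‖symbol S z‖ = ‖P * T‖⁻¹ * ‖symbol T z‖ := fun z => by
    rw [symbol_smul_apply, norm_mul, norm_inv, Complex.norm_real, norm_norm]
  have hmax : ∀ z ∈ component A x₀, symbol S z = symbol S y := fun z hz => by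
    refine eq_of_norm_eq_one_of_mem_component hL2 hH hA (symbol_mem_symbols hM S)
      (fun z hz => ?_) hyx ?_ hz
    · rw [hS]
      exact inv_mul_le_one_of_le₀ (hle z hz) hpos.le
    · rw [hS, (hle y hyx).antisymm hy, inv_mul_cancel₀ hpos.ne']
  have heq : symbol S z = symbol S x₀ :=
    (hmax z hz).trans (hmax x₀ (mem_component_self A x₀)).symm
  rw [symbol_smul_apply, symbol_smul_apply] at heq
  exact mul_left_cancel₀ hc heq

lemma exists_isEscaping_le_norm (hL2 : IsSubspaceL2 H μ)
    (hH : ∀ x : X, ∃ f : H, f x ≠ 0) (hA : IsDualAlgebraOfMultipliers A)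
    (hP : IsRestrictionTo P (component A x₀)) (hconst : ¬ IsConstantOnComponent A x₀)
    (s : Finset H) {δ : ℝ} (hδ : 0 < δ) {a : ℝ} (ha : a < 1) :
    ∃ u : H, P u = u ∧ IsEscaping s δ (fun _ : Unit => u) ∧ a ≤ ‖u‖ := by
  have hM := hA.subset_multipliers
  obtain ⟨θ, hθ, z, hz, hne⟩ : ∃ θ ∈ symbols A, ∃ z ∈ component A x₀, θ z ≠ θ x₀ := by
    simpa [IsConstantOnComponent] using hconst
  obtain ⟨T, rfl⟩ := exists_symbol_eq hH hθ
  have hlt : ∀ x, ‖symbol (P * T) x‖ < ‖P * T‖ := fun x => by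
    by_contra! h
    exact hne (symbol_eq_of_norm_le_norm_symbol hL2 hH hA hP h hz)
  obtain ⟨w, hw, haw⟩ := hL2.exists_isEscaping_of_norm_symbol_lt hM hlt s hδ ha
  refine ⟨(P * T) w, hP.apply_mul_apply hM T w, hw, le_of_mul_le_mul_right (haw.trans ?_)
    ((norm_nonneg _).trans_lt (hlt x₀))⟩
  exact (OpAlgebra.norm_apply_le _ _).trans_eq (mul_comm _ _)

lemma exists_isEscaping_mul_norm_le (hL2 : IsSubspaceL2 H μ)
    (hH : ∀ x : X, ∃ f : H, f x ≠ 0) (hA : IsDualAlgebraOfMultipliers A)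
    (hP : IsRestrictionTo P (component A x₀)) (hconst : ¬ IsConstantOnComponent A x₀)
    (T : OpAlgebra A) (s : Finset H) {δ : ℝ} (hδ : 0 < δ) {a : ℝ} (ha : a < 1) :
    ∃ u : H, P u = u ∧ IsEscaping s δ (fun _ : Unit => u) ∧ a * ‖P * T‖ ≤ ‖T u‖ := by
  have hM := hA.subset_multipliers
  by_cases hlt : ∀ x, ‖symbol (P * T) x‖ < ‖P * T‖
  · obtain ⟨w, hw, haw⟩ := hL2.exists_isEscaping_of_norm_symbol_lt hM hlt s hδ ha
    have hPw := hP.apply_mul_apply hM T w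
    exact ⟨(P * T) w, hPw, hw, by rwa [mul_apply_of_apply_eq hM T hPw] at haw⟩
  -- Otherwise `T` acts on the component as a scalar of modulus `‖P * T‖`.
  push Not at hlt
  obtain ⟨y, hy⟩ := hlt
  obtain ⟨u, hPu, hu, hau⟩ := exists_isEscaping_le_norm hL2 hH hA hP hconst s hδ ha
  have hT : ∀ z ∈ component A x₀, symbol T z = symbol T x₀ := fun z hz =>
    symbol_eq_of_norm_le_norm_symbol hL2 hH hA hP hy hz
  have hTu : T u = symbol T x₀ • u := RKHS.ext fun z => by
    rw [apply_eq_symbol_mul hM, RKHS.coe_smul, Pi.smul_apply, smul_eq_mul]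
    by_cases hz : z ∈ component A x₀
    · rw [hT z hz]
    · rw [hP.apply_eq_zero hM hPu hz, mul_zero, mul_zero]
  have hle : ‖P * T‖ ≤ ‖symbol T x₀‖ := hL2.norm_le_of_norm_symbol_le hM (norm_nonneg _) fun z => by
    by_cases hz : z ∈ component A x₀
    · rw [hP.symbol_mul_of_mem hM T hz, hT z hz]
    · rw [hP.symbol_mul_of_notMem hM T hz, norm_zero]
      exact norm_nonneg _
  refine ⟨u, hPu, hu, ?_⟩
  rw [hTu, norm_smul, mul_comm]
  exact (mul_le_mul_of_nonneg_left hau (norm_nonneg _)).trans (by gcongr)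

/-- The vector functionals `[v, u]` with `‖v‖ ≤ 1`, where `u` is fixed by `P`, has norm at most
`1`, and is orthogonal to the vectors of `s` up to `δ`. -/
def escapingFunctionals (P : OpAlgebra A) (s : Finset H) (δ : ℝ) :
    Set (StrongDual ℂ (OpAlgebra A)) :=
  {L | ∃ u v : H, P u = u ∧ IsEscaping s δ (fun _ : Unit => u) ∧ ‖v‖ ≤ 1 ∧
    vectorFunctional A v u = L}

lemma mem_closure_convexHull_escapingFunctionals (hL2 : IsSubspaceL2 H μ)
    (hH : ∀ x : X, ∃ f : H, f x ≠ 0) (hA : IsDualAlgebraOfMultipliers A)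
    (hP : IsRestrictionTo P (component A x₀)) (hconst : ¬ IsConstantOnComponent A x₀)
    {R : StrongDual ℂ (OpAlgebra A)} (hR : R ∈ predual A) (hR1 : ‖R‖ ≤ 1)
    (hRP : ∀ T, R (P * T) = R T) (s : Finset H) {δ : ℝ} (hδ : 0 < δ) :
    R ∈ closure (convexHull ℝ (escapingFunctionals P s δ)) := by
  by_contra hnot
  obtain ⟨ξ, r, hr, hrR⟩ := RCLike.geometric_hahn_banach_closed_point (𝕜 := ℂ)
    (convex_convexHull ℝ _).closure isClosed_closure hnot
  obtain ⟨T, hT⟩ := exists_forall_predual_eq_apply hA.isDualAlgebra ξ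
  have hrT : r < 1 * ‖P * T‖ := by
    rw [hT R hR, ← hRP T] at hrR
    refine hrR.trans_le ((RCLike.re_le_norm _).trans ((R.le_opNorm _).trans ?_))
    gcongr
  obtain ⟨a, hra, ha⟩ : ∃ a, r < a * ‖P * T‖ ∧ a < 1 :=
    (((tendsto_id.mul_const ‖P * T‖).mono_left nhdsWithin_le_nhds).eventually_const_lt hrT
      |>.and self_mem_nhdsWithin).exists (f := 𝓝[<] (1 : ℝ))
  obtain ⟨u, hPu, hu, hau⟩ := exists_isEscaping_mul_norm_le hL2 hH hA hP hconst T s hδ ha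
  obtain ⟨v, hv, hvu⟩ := exists_inner_eq_norm (T u)
  have hlt := hr (vectorFunctional A v u)
    (subset_closure (subset_convexHull ℝ _ ⟨u, v, hPu, hu, hv, rfl⟩))
  rw [hT _ (vectorFunctional_mem_predual A v u), vectorFunctional_apply, hvu] at hlt
  exact (hra.trans_le hau).not_gt hlt

end EscapingVectors

section Reduction

lemma exists_norm_le_one_norm_sub_le_re {E : Type*} [NormedAddCommGroup E] [NormedSpace ℂ E]
    (R : StrongDual ℂ E) {ε : ℝ} (hε : 0 < ε) : ∃ T : E, ‖T‖ ≤ 1 ∧ ‖R‖ - ε ≤ (R T).re := by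
  obtain ⟨T, hT, hRT⟩ := R.exists_lt_apply_of_lt_opNorm (sub_lt_self ‖R‖ hε)
  obtain ⟨c, hc, hcT⟩ : ∃ c : ℂ, ‖c‖ ≤ 1 ∧ c * R T = ‖R T‖ := by
    obtain ⟨c, hc, hcT⟩ := exists_inner_eq_norm (R T)
    exact ⟨conj c, by simpa using hc, by simpa [mul_comm] using hcT⟩
  refine ⟨c • T, ?_, ?_⟩
  · rw [norm_smul]
    exact mul_le_one₀ hc (norm_nonneg _) hT.le
  · rw [map_smul, smul_eq_mul, hcT, Complex.ofReal_re]
    exact hRT.le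

lemma norm_sqrt_smul_sq {E : Type*} [NormedAddCommGroup E] [NormedSpace ℂ E] {r : ℝ} (hr : 0 ≤ r)
    (v : E) : ‖(√r : ℂ) • v‖ ^ 2 = r * ‖v‖ ^ 2 := by
  rw [norm_smul, mul_pow, Complex.norm_real, Real.norm_eq_abs, sq_abs, Real.sq_sqrt hr]

variable {X H : Type*} [NormedAddCommGroup H] [InnerProductSpace ℂ H]
  {A : Subalgebra ℂ (H →L[ℂ] H)}

lemma vectorFunctional_sqrt_smul {r : ℝ} (hr : 0 ≤ r) (v u : H) :
    vectorFunctional A ((√r : ℂ) • v) ((√r : ℂ) • u) = (r : ℂ) • vectorFunctional A v u := by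
  rw [map_smul, map_smulₛₗ, Complex.conj_ofReal, smul_apply, smul_smul, ← Complex.ofReal_mul,
    Real.mul_self_sqrt hr]

lemma norm_sum_vectorFunctional_sub_le {ι : Type*} [Fintype ι] {U V : ι → H} {Φ : OpAlgebra A}
    (hΦ : ‖Φ‖ ≤ 1) (hU : ∑ j, ‖U j‖ ^ 2 ≤ 1) (hV : ∑ j, ‖V j‖ ^ 2 ≤ 1) {ε : ℝ} (hε : 0 ≤ ε)
    (h : 1 - ε ^ 2 / 2 ≤ ((∑ j, vectorFunctional A (V j) (U j)) Φ).re) :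
    ‖∑ j, vectorFunctional A (V j) (U j) - ∑ j, vectorFunctional A (Φ (U j)) (U j)‖ ≤ ε := by
  have hΦU : ∀ j, ‖Φ (U j)‖ ≤ ‖U j‖ := fun j =>
    (OpAlgebra.norm_apply_le _ _).trans (mul_le_of_le_one_left (norm_nonneg _) hΦ)
  have hdist : ∑ j, ‖V j - Φ (U j)‖ ^ 2 ≤ ε ^ 2 := calc
    ∑ j, ‖V j - Φ (U j)‖ ^ 2
        ≤ ∑ j, (‖V j‖ ^ 2 - 2 * (inner ℂ (V j) (Φ (U j))).re + ‖U j‖ ^ 2) := by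
      gcongr with j
      rw [norm_sub_sq (𝕜 := ℂ)]
      gcongr
      · exact le_rfl
      · exact hΦU j
    _ = ∑ j, ‖V j‖ ^ 2 - 2 * ((∑ j, vectorFunctional A (V j) (U j)) Φ).re
          + ∑ j, ‖U j‖ ^ 2 := by
      simp [Finset.sum_add_distrib, Finset.mul_sum]
    _ ≤ ε ^ 2 := by linarith
  calc ‖∑ j, vectorFunctional A (V j) (U j) - ∑ j, vectorFunctional A (Φ (U j)) (U j)‖
      ≤ ∑ j, ‖V j - Φ (U j)‖ * ‖U j‖ := by
        rw [← Finset.sum_sub_distrib]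
        refine norm_sum_le_of_le _ fun j _ => ?_
        simpa only [map_sub, sub_apply] using norm_vectorFunctional_le A (V j - Φ (U j)) (U j)
    _ ≤ √(∑ j, ‖V j - Φ (U j)‖ ^ 2) * √(∑ j, ‖U j‖ ^ 2) := Real.sum_mul_le_sqrt_mul_sqrt _ _ _
    _ ≤ √(ε ^ 2) * √1 := by gcongr
    _ = ε := by rw [Real.sqrt_sq hε, Real.sqrt_one, mul_one]

variable [RKHS ℂ H X ℂ] {P : OpAlgebra A}

lemma apply_signSum_eq {ι : Type*} [DecidableEq ι] {U : ι → H} (hU : ∀ j, P (U j) = U j)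
    (s t : Finset ι) : P (signSum U s t) = signSum U s t := by
  rw [signSum, map_sum]
  refine Finset.sum_congr rfl fun j _ => ?_
  split_ifs
  · exact hU j
  · rw [map_neg, hU]

lemma exists_isEscaping_sum_eq_of_mem_convexHull {s : Finset H} {δ : ℝ}
    {Q : StrongDual ℂ (OpAlgebra A)} (hQ : Q ∈ convexHull ℝ (escapingFunctionals P s δ)) :
    ∃ (ι : Type) (_ : Fintype ι) (U V : ι → H), (∀ j, P (U j) = U j) ∧ IsEscaping s δ U ∧
      ∑ j, ‖V j‖ ^ 2 ≤ 1 ∧ ∑ j, vectorFunctional A (V j) (U j) = Q := by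
  obtain ⟨ι, _, t, q, ht, ht1, hq, rfl⟩ := mem_convexHull_iff_exists_fintype.1 hQ
  choose u v hPu hu hv huv using hq
  have hsum : ∀ {f : ι → ℝ} {c : ℝ}, (∀ j, f j ≤ c) → ∑ j, t j * f j ≤ c := fun {f c} hf =>
    calc ∑ j, t j * f j ≤ ∑ j, t j * c := by gcongr with j; exacts [ht j, hf j]
      _ = c := by rw [← Finset.sum_mul, ht1, one_mul]
  refine ⟨ι, inferInstance, fun j => (√(t j) : ℂ) • u j, fun j => (√(t j) : ℂ) • v j,
    fun j => by rw [map_smul, hPu], ⟨?_, fun e he => ?_⟩, ?_, ?_⟩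
  · simp only [norm_sqrt_smul_sq (ht _)]
    exact hsum fun j => by simpa using (hu j).1
  · simp only [inner_smul_right_eq_smul, norm_sqrt_smul_sq (ht _)]
    exact hsum fun j => by simpa using (hu j).2 e he
  · simp only [norm_sqrt_smul_sq (ht _)]
    exact hsum fun j => pow_le_one₀ (norm_nonneg _) (hv j)
  · refine Finset.sum_congr rfl fun j _ => ?_
    rw [vectorFunctional_sqrt_smul (ht j), huv]
    exact Complex.coe_smul (t j) (q j)

variable [MeasurableSpace X] {μ : Measure X}

lemma integral_norm_sqrt_smul_mul (r : ℝ) (a : H) (F : X → ℝ) :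
    ∫ x, ‖((√r : ℂ) • a) x‖ * F x ∂μ = √r * ∫ x, ‖a x‖ * F x ∂μ := by
  simp only [← integral_const_mul, RKHS.coe_smul, Pi.smul_apply, norm_smul, Complex.norm_real,
    Real.norm_of_nonneg (Real.sqrt_nonneg r), mul_assoc]

variable [CompleteSpace H] {x₀ : X}

lemma IsSubspaceL2.vectorFunctional_eq_integral (hL2 : IsSubspaceL2 H μ)
    (hM : (A : Set (H →L[ℂ] H)) ⊆ multiplierAlgebra H) (b a : H) (T : OpAlgebra A) :
    vectorFunctional A b a T = ∫ x, symbol T x * (conj (b x) * a x) ∂μ := by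
  rw [vectorFunctional_apply, hL2.inner_eq_integral]
  refine integral_congr_ae (Eventually.of_forall fun x => ?_)
  simp only [apply_eq_symbol_mul hM T, mul_left_comm]

lemma norm_le_integral_norm_of_eq_integral {R : StrongDual ℂ (OpAlgebra A)} {k : X → ℂ}
    (hk : Integrable k μ) (hR : ∀ T, R T = ∫ x, symbol T x * k x ∂μ) :
    ‖R‖ ≤ ∫ x, ‖k x‖ ∂μ := by
  refine R.opNorm_le_bound (integral_nonneg fun x => norm_nonneg _) fun T => ?_
  rw [hR, mul_comm, ← integral_const_mul]
  refine norm_integral_le_of_norm_le (hk.norm.const_mul _) (Eventually.of_forall fun x => ?_)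
  rw [norm_mul]
  gcongr
  exact norm_symbol_le T x

lemma IsSubspaceL2.norm_sum_vectorFunctional_sub_smul_le (hL2 : IsSubspaceL2 H μ)
    (hM : (A : Set (H →L[ℂ] H)) ⊆ multiplierAlgebra H) {Φ : OpAlgebra A} (hΦ : ‖Φ‖ ≤ 1)
    {ι : Type*} [Fintype ι] (U : ι → H) (w : H) (l : ℝ) :
    ‖∑ j, vectorFunctional A (Φ (U j)) (U j) - (l : ℂ) • vectorFunctional A (Φ w) w‖ ≤
      ∫ x, |∑ j, ‖U j x‖ ^ 2 - l * ‖w x‖ ^ 2| ∂μ := by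
  have hint : ∀ u : H, Integrable (fun x => conj (Φ u x) * u x) μ := fun u =>
    hL2.integrable_mul _ _
  have hint' : ∀ (T : OpAlgebra A) (u : H),
      Integrable (fun x => symbol T x * (conj (Φ u x) * u x)) μ := fun T u => by
    convert hL2.integrable_mul (Φ u) (T u) using 2 with x
    rw [apply_eq_symbol_mul hM T, mul_left_comm]
  have hk : Integrable (fun x => ∑ j, conj (Φ (U j) x) * U j x - l * (conj (Φ w x) * w x)) μ :=
    (integrable_finsetSum _ fun j _ => hint _).sub ((hint _).const_mul _)
  refine (norm_le_integral_norm_of_eq_integral hk fun T => ?_).trans ?_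
  · simp only [sub_apply, sum_apply, smul_apply, smul_eq_mul,
      hL2.vectorFunctional_eq_integral hM, mul_sub, Finset.mul_sum, mul_left_comm _ (l : ℂ)]
    rw [integral_sub (integrable_finsetSum _ fun j _ => hint' _ _) ((hint' _ _).const_mul _),
      integral_finsetSum _ fun j _ => hint' _ _, integral_const_mul]
  · have hdens : ∀ (u : H) (x : X), conj (Φ u x) * u x = conj (symbol Φ x) * (‖u x‖ ^ 2 : ℝ) :=
      fun u x => by
        rw [apply_eq_symbol_mul hM, map_mul, mul_assoc, Complex.conj_mul']
        push_cast; rfl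
    refine integral_mono hk.norm ((hL2.integrable_sum_norm_sq U).sub
      ((hL2.integrable_norm_sq w).const_mul l)).abs fun x => ?_
    simp only [hdens]
    rw [← Finset.mul_sum, mul_left_comm, ← mul_sub, norm_mul, RCLike.norm_conj,
      ← Complex.ofReal_sum, ← Complex.ofReal_mul, ← Complex.ofReal_sub, Complex.norm_real]
    exact mul_le_of_le_one_left (norm_nonneg _) ((norm_symbol_le Φ x).trans hΦ)

lemma exists_norm_sub_sum_vectorFunctional_le (hL2 : IsSubspaceL2 H μ)
    (hH : ∀ x : X, ∃ f : H, f x ≠ 0) (hA : IsDualAlgebraOfMultipliers A)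
    (hP : IsRestrictionTo P (component A x₀)) (hconst : ¬ IsConstantOnComponent A x₀)
    {R : StrongDual ℂ (OpAlgebra A)} (hR : R ∈ predual A) (hR1 : ‖R‖ = 1)
    (hRP : ∀ T, R (P * T) = R T) {F : X → ℝ} (hF : MemLp F 2 μ) (hF0 : ∀ x, 0 ≤ F x)
    {ε τ : ℝ} (hε : 0 < ε) (hτ : 0 < τ) :
    ∃ (Φ : OpAlgebra A) (ι : Type) (_ : Fintype ι) (U : ι → H), ‖Φ‖ ≤ 1 ∧
      (∀ j, P (U j) = U j) ∧ ∑ j, ‖U j‖ ^ 2 ≤ 1 ∧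
      ‖R - ∑ j, vectorFunctional A (Φ (U j)) (U j)‖ ≤ ε ∧
      ∫ x, √(∑ j, ‖U j x‖ ^ 2) * F x ∂μ ≤ τ := by
  obtain ⟨s, δ, hδ, hs⟩ := hL2.exists_forall_integral_sqrt_mul_le hF hF0 hτ
  obtain ⟨ε', hε', hε'2, hε'ε⟩ : ∃ ε' > 0, 2 * ε' ≤ (ε / 2) ^ 2 / 2 ∧ ε' ≤ ε / 2 :=
    ⟨min ((ε / 2) ^ 2 / 4) (ε / 2), by positivity,
      by linarith [min_le_left ((ε / 2) ^ 2 / 4) (ε / 2)], min_le_right _ _⟩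
  obtain ⟨Q, hQ, hRQ⟩ := Metric.mem_closure_iff.1
    (mem_closure_convexHull_escapingFunctionals hL2 hH hA hP hconst hR hR1.le hRP s hδ) ε' hε'
  rw [dist_eq_norm] at hRQ
  obtain ⟨ι, _, U, V, hPU, hU, hV, rfl⟩ := exists_isEscaping_sum_eq_of_mem_convexHull hQ
  obtain ⟨Φ, hΦ, hRΦ⟩ := exists_norm_le_one_norm_sub_le_re R hε'
  have hclose := norm_sum_vectorFunctional_sub_le hΦ hU.1 hV (half_pos hε).le (by
    have hdiff : ((R - ∑ j, vectorFunctional A (V j) (U j)) Φ).re ≤ ε' :=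
      (Complex.re_le_norm _).trans (((R - _).le_of_opNorm_le hRQ.le Φ).trans
        (mul_le_of_le_one_right hε'.le hΦ))
    rw [sub_apply, Complex.sub_re] at hdiff
    linarith)
  exact ⟨Φ, ι, inferInstance, U, hΦ, hPU, hU.1,
    (norm_sub_le_norm_sub_add_norm_sub _ _ _).trans (by linarith), hs ι U hU⟩

lemma exists_norm_sub_vectorFunctional_le_of_norm_eq_one (hL2 : IsSubspaceL2 H μ)
    (hH : ∀ x : X, ∃ f : H, f x ≠ 0) (hA : IsDualAlgebraOfMultipliers A)
    (hP : IsRestrictionTo P (component A x₀)) (hconst : ¬ IsConstantOnComponent A x₀)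
    {R : StrongDual ℂ (OpAlgebra A)} (hR : R ∈ predual A) (hR1 : ‖R‖ = 1)
    (hRP : ∀ T, R (P * T) = R T) {F : X → ℝ} (hF : MemLp F 2 μ) (hF0 : ∀ x, 0 ≤ F x)
    {η τ : ℝ} (hη0 : 0 < η) (hη1 : η ≤ 1) (hτ : 0 < τ) :
    ∃ a b : H, P a = a ∧ (∀ x, ‖b x‖ ≤ ‖a x‖) ∧
      ‖R - vectorFunctional A b a‖ + (1 - η) * ‖a‖ ^ 2 ≤ 1 - η ^ 2 / 12 ∧
      ∫ x, ‖a x‖ * F x ∂μ ≤ τ := by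
  classical
  have hM := hA.subset_multipliers
  obtain ⟨Φ, ι, _, U, hΦ, hPU, hU, hRU, hUF⟩ := exists_norm_sub_sum_vectorFunctional_le hL2 hH hA
    hP hconst hR hR1 hRP hF hF0 (ε := η ^ 2 / 24) (τ := τ * (η ^ 2 / 24)) (by positivity)
    (by positivity)
  -- `l = η / 3` minimizes the coefficient `1 - η * l + 3 / 2 * l ^ 2`.
  have hl : 0 ≤ η / 3 := by positivity
  obtain ⟨t, ht⟩ := hL2.exists_signSum U hF hF0 (l := η / 3) (η := η) (D := τ⁻¹) (by positivity)
  set w : H := signSum U Finset.univ t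
  have hcoef : (1 - η * (η / 3) + 3 / 2 * (η / 3) ^ 2) * ∑ j, ‖U j‖ ^ 2 ≤ 1 - η ^ 2 / 6 := by
    rw [show 1 - η * (η / 3) + 3 / 2 * (η / 3) ^ 2 = 1 - η ^ 2 / 6 by ring]
    exact mul_le_of_le_one_right (by nlinarith) hU
  have hDU : τ⁻¹ * ∫ x, √(∑ j, ‖U j x‖ ^ 2) * F x ∂μ ≤ η ^ 2 / 24 :=
    (inv_mul_le_iff₀ hτ).2 hUF
  have hRw : ‖R - ((η / 3 : ℝ) : ℂ) • vectorFunctional A (Φ w) w‖ ≤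
      η ^ 2 / 24 + ∫ x, |∑ j, ‖U j x‖ ^ 2 - η / 3 * ‖w x‖ ^ 2| ∂μ :=
    (norm_sub_le_norm_sub_add_norm_sub _ _ _).trans (add_le_add hRU
      (hL2.norm_sum_vectorFunctional_sub_smul_le hM hΦ U w (η / 3)))
  have hwF : 0 ≤ ∫ x, ‖w x‖ * F x ∂μ :=
    integral_nonneg fun x => mul_nonneg (norm_nonneg _) (hF0 x)
  have : ‖R - ((η / 3 : ℝ) : ℂ) • vectorFunctional A (Φ w) w‖
      + (1 - η) * (η / 3 * ‖w‖ ^ 2) + τ⁻¹ * ∫ x, ‖w x‖ * F x ∂μ ≤ 1 - η ^ 2 / 12 := by linarith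
  have hη' : 0 ≤ (1 - η) * (η / 3 * ‖w‖ ^ 2) := mul_nonneg (sub_nonneg.2 hη1) (by positivity)
  refine ⟨(√(η / 3) : ℂ) • w, (√(η / 3) : ℂ) • Φ w, ?_, fun x => ?_, ?_, ?_⟩
  · rw [map_smul, apply_signSum_eq hPU]
  · simp only [RKHS.coe_smul, Pi.smul_apply, norm_smul, apply_eq_symbol_mul hM, norm_mul]
    gcongr
    exact mul_le_of_le_one_left (norm_nonneg _) ((norm_symbol_le Φ x).trans hΦ)
  · rw [vectorFunctional_sqrt_smul hl, norm_sqrt_smul_sq hl]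
    linarith [mul_nonneg (inv_nonneg.2 hτ.le) hwF]
  · rw [integral_norm_sqrt_smul_mul]
    refine (mul_le_of_le_one_left hwF (Real.sqrt_le_one.2 (by linarith))).trans ?_
    rw [← inv_mul_le_one₀ hτ]
    linarith [norm_nonneg (R - ((η / 3 : ℝ) : ℂ) • vectorFunctional A (Φ w) w), sq_nonneg η]

lemma exists_norm_sub_vectorFunctional_le (hL2 : IsSubspaceL2 H μ)
    (hH : ∀ x : X, ∃ f : H, f x ≠ 0) (hA : IsDualAlgebraOfMultipliers A)
    (hP : IsRestrictionTo P (component A x₀)) (hconst : ¬ IsConstantOnComponent A x₀)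
    {R : StrongDual ℂ (OpAlgebra A)} (hR : R ∈ predual A) (hRP : ∀ T, R (P * T) = R T)
    {F : X → ℝ} (hF : MemLp F 2 μ) (hF0 : ∀ x, 0 ≤ F x)
    {η τ : ℝ} (hη0 : 0 < η) (hη1 : η ≤ 1) (hτ : 0 < τ) :
    ∃ a b : H, P a = a ∧ (∀ x, ‖b x‖ ≤ ‖a x‖) ∧
      ‖R - vectorFunctional A b a‖ + (1 - η) * ‖a‖ ^ 2 ≤ (1 - η ^ 2 / 12) * ‖R‖ ∧
      ∫ x, ‖a x‖ * F x ∂μ ≤ τ := by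
  rcases eq_or_ne R 0 with rfl | hR0
  · exact ⟨0, 0, by simp, by simp, by simp, by simpa using hτ.le⟩
  have hr : 0 < ‖R‖ := norm_pos_iff.2 hR0
  obtain ⟨a, b, ha, hba, hle, hint⟩ := exists_norm_sub_vectorFunctional_le_of_norm_eq_one hL2 hH
    hA hP hconst ((predual A).smul_mem (‖R‖ : ℂ)⁻¹ hR) (norm_smul_inv_norm hR0)
    (fun T => by simp only [smul_apply, hRP]) hF hF0 hη0 hη1 (τ := τ / √‖R‖) (by positivity)
  refine ⟨(√‖R‖ : ℂ) • a, (√‖R‖ : ℂ) • b, by rw [map_smul, ha], fun x => ?_, ?_, ?_⟩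
  · simp only [RKHS.coe_smul, Pi.smul_apply, norm_smul]
    gcongr
    exact hba x
  · have hsub : R - vectorFunctional A ((√‖R‖ : ℂ) • b) ((√‖R‖ : ℂ) • a) =
        (‖R‖ : ℂ) • ((‖R‖ : ℂ)⁻¹ • R - vectorFunctional A b a) := by
      rw [vectorFunctional_sqrt_smul hr.le, smul_sub, smul_inv_smul₀ (by exact_mod_cast hr.ne')]
    calc _ = (‖(‖R‖ : ℂ)⁻¹ • R - vectorFunctional A b a‖ + (1 - η) * ‖a‖ ^ 2) * ‖R‖ := by
          rw [hsub, norm_smul, norm_sqrt_smul_sq hr.le, Complex.norm_real, norm_norm]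
          ring
      _ ≤ (1 - η ^ 2 / 12) * ‖R‖ := by gcongr
  · rw [integral_norm_sqrt_smul_mul, mul_comm]
    exact (le_div_iff₀ (Real.sqrt_pos.2 hr)).1 hint

end Reduction

section Factorization

lemma norm_add_sq_le_of_norm_inner_le {E : Type*} [NormedAddCommGroup E] [InnerProductSpace ℂ E]
    {h c : E} {τ : ℝ} (hτ : ‖inner ℂ h c‖ ≤ τ) : ‖h + c‖ ^ 2 ≤ ‖h‖ ^ 2 + 2 * τ + ‖c‖ ^ 2 := by
  rw [norm_add_sq (𝕜 := ℂ)]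
  gcongr
  exact (RCLike.re_le_norm _).trans hτ

lemma exists_mem_eq_zero_of_forall_exists_le {E : Type*} [MetricSpace E] [CompleteSpace E]
    {r : E → ℝ} (hr : Continuous r) (hr0 : ∀ p, 0 ≤ r p) {S : Set E} (hS : IsClosed S)
    (hne : S.Nonempty) {ρ C : ℝ} (hρ0 : 0 ≤ ρ) (hρ1 : ρ < 1)
    (hstep : ∀ p ∈ S, ∃ q ∈ S, r q ≤ ρ * r p ∧ dist p q ^ 2 ≤ C * r p) : ∃ q ∈ S, r q = 0 := by
  choose! step hstepS hstepr hstepd using hstep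
  obtain ⟨p₀, hp₀⟩ := hne
  let q : ℕ → E := fun n => step^[n] p₀
  have hsucc : ∀ n, q (n + 1) = step (q n) := fun n => Function.iterate_succ_apply' _ _ _
  have hqS : ∀ n, q n ∈ S := fun n => by
    induction n with
    | zero => exact hp₀
    | succ n ih => rw [hsucc]; exact hstepS _ ih
  have hqr : ∀ n, r (q n) ≤ ρ ^ n * r p₀ := fun n => by
    induction n with
    | zero => simp [q]
    | succ n ih =>
      rw [hsucc, pow_succ', mul_assoc]
      exact (hstepr _ (hqS n)).trans (by gcongr)
  have hqd : ∀ n, dist (q n) (q (n + 1)) ≤ √(|C| * r p₀) * √ρ ^ n := fun n => by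
    rw [hsucc, ← Real.sqrt_sq (pow_nonneg (Real.sqrt_nonneg ρ) n), ← pow_mul, mul_comm n, pow_mul,
      Real.sq_sqrt hρ0, ← Real.sqrt_mul (by have := hr0 p₀; positivity)]
    refine Real.le_sqrt_of_sq_le ((hstepd _ (hqS n)).trans ?_)
    calc C * r (q n) ≤ |C| * (ρ ^ n * r p₀) :=
          mul_le_mul (le_abs_self C) (hqr n) (hr0 _) (abs_nonneg C)
      _ = |C| * r p₀ * ρ ^ n := by ring
  obtain ⟨p, hp⟩ := cauchySeq_tendsto_of_complete
    (cauchySeq_of_le_geometric _ _ ((Real.sqrt_lt' one_pos).2 (by simpa using hρ1)) hqd)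
  have hlim : Tendsto (fun n => r (q n)) atTop (𝓝 0) :=
    squeeze_zero (fun n => hr0 _) hqr
      (by simpa using (tendsto_pow_atTop_nhds_zero_of_lt_one hρ0 hρ1).mul_const (r p₀))
  exact ⟨p, hS.mem_of_tendsto hp (Eventually.of_forall hqS),
    tendsto_nhds_unique ((hr.tendsto p).comp hp) hlim⟩

variable {X H : Type*} [NormedAddCommGroup H] [InnerProductSpace ℂ H]
  {A : Subalgebra ℂ (H →L[ℂ] H)} {L : StrongDual ℂ (OpAlgebra A)} {η κ : ℝ} {p q : H × H}

lemma norm_inner_le_norm_vectorFunctional (g f : H) :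
    ‖inner ℂ g f‖ ≤ ‖vectorFunctional A g f‖ := by
  simpa using (vectorFunctional A g f).le_of_opNorm_le_of_le le_rfl
    (show ‖(1 : OpAlgebra A)‖ ≤ 1 from ContinuousLinearMap.norm_id_le)

/-- The distance from `L` to the vector functional defined by the pair `p`. -/
def residual (L : StrongDual ℂ (OpAlgebra A)) (p : H × H) : ℝ :=
  ‖L - vectorFunctional A p.2 p.1‖

lemma continuous_residual (L : StrongDual ℂ (OpAlgebra A)) : Continuous (residual L) := by
  unfold residual
  fun_prop

lemma residual_add_le (L : StrongDual ℂ (OpAlgebra A)) (p q : H × H) :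
    residual L (p + q) ≤ ‖L - vectorFunctional A p.2 p.1 - vectorFunctional A q.2 q.1‖ +
      ‖vectorFunctional A p.2 q.1‖ + ‖vectorFunctional A q.2 p.1‖ := by
  have hexpand : L - vectorFunctional A (p + q).2 (p + q).1 =
      L - vectorFunctional A p.2 p.1 - vectorFunctional A q.2 q.1 -
        vectorFunctional A p.2 q.1 - vectorFunctional A q.2 p.1 := by
    simp only [Prod.fst_add, Prod.snd_add, map_add, add_apply]
    abel
  rw [residual, hexpand]
  exact (norm_sub_le _ _).trans (by gcongr; exact norm_sub_le _ _)

variable [RKHS ℂ H X ℂ] {s : Finset X}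

/-- `q` approximates `L` better than `p` does, and each change from `p` to `q` (in the squared
norms, and in the values of the first vector on `s`) is paid for by the decrease of the
residual. -/
structure Improves (L : StrongDual ℂ (OpAlgebra A)) (s : Finset X) (η κ : ℝ) (p q : H × H) :
    Prop where
  norm_fst : (1 - η) * ‖q.1‖ ^ 2 + residual L q ≤ (1 - η) * ‖p.1‖ ^ 2 + residual L p
  norm_snd : (1 - η) * ‖q.2‖ ^ 2 + residual L q ≤ (1 - η) * ‖p.2‖ ^ 2 + residual L p
  norm_sub_apply : ∀ y ∈ s, ‖q.1 y - p.1 y‖ ≤ κ * (residual L p - residual L q)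

lemma Improves.refl (L : StrongDual ℂ (OpAlgebra A)) (s : Finset X) (η κ : ℝ) (p : H × H) :
    Improves L s η κ p p :=
  ⟨le_rfl, le_rfl, fun y _ => by simp⟩

lemma Improves.trans {p₀ : H × H} (hp : Improves L s η κ p₀ p) (hq : Improves L s η κ p q) :
    Improves L s η κ p₀ q where
  norm_fst := hq.norm_fst.trans hp.norm_fst
  norm_snd := hq.norm_snd.trans hp.norm_snd
  norm_sub_apply y hy := by
    linarith [norm_sub_le_norm_sub_add_norm_sub (q.1 y) (p.1 y) (p₀.1 y),
      hp.norm_sub_apply y hy, hq.norm_sub_apply y hy]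

lemma isClosed_setOf_improves (L : StrongDual ℂ (OpAlgebra A)) (s : Finset X) (η κ : ℝ)
    (p : H × H) : IsClosed {q | Improves L s η κ p q} := by
  have hr := continuous_residual L
  have heval : ∀ y : X, Continuous fun q : H × H => q.1 y := fun y =>
    (RKHS.continuous_eval y).comp continuous_fst
  have hset : {q | Improves L s η κ p q} =
      {q | (1 - η) * ‖q.1‖ ^ 2 + residual L q ≤ (1 - η) * ‖p.1‖ ^ 2 + residual L p} ∩
      {q | (1 - η) * ‖q.2‖ ^ 2 + residual L q ≤ (1 - η) * ‖p.2‖ ^ 2 + residual L p} ∩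
      ⋂ y ∈ s, {q | ‖q.1 y - p.1 y‖ ≤ κ * (residual L p - residual L q)} := by
    ext q
    simp only [Set.mem_ofPred_eq, Set.mem_inter_iff, Set.mem_iInter]
    exact ⟨fun h => ⟨⟨h.1, h.2⟩, h.3⟩, fun h => ⟨h.1.1, h.1.2, h.2⟩⟩
  rw [hset]
  refine ((isClosed_le (by fun_prop) (by fun_prop)).inter
    (isClosed_le (by fun_prop) (by fun_prop))).inter (isClosed_biInter fun y _ => ?_)
  have := heval y
  exact isClosed_le (by fun_prop) (by fun_prop)

variable [MeasurableSpace X] {μ : Measure X}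

lemma IsSubspaceL2.integral_norm_mul_norm_le (hL2 : IsSubspaceL2 H μ) {a c h : H}
    (hc : ∀ x, ‖c x‖ ≤ ‖a x‖) {F : X → ℝ} (hF : MemLp F 2 μ) (hhF : ∀ x, ‖h x‖ ≤ F x) :
    ∫ x, ‖c x‖ * ‖h x‖ ∂μ ≤ ∫ x, ‖a x‖ * F x ∂μ :=
  integral_mono ((hL2.memLp c).norm.integrable_mul (hL2.memLp h).norm)
    ((hL2.memLp a).norm.integrable_mul hF)
    fun x => mul_le_mul (hc x) (hhF x) (norm_nonneg _) (norm_nonneg _)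

variable [CompleteSpace H] {P : OpAlgebra A} {x₀ : X}

lemma IsSubspaceL2.norm_vectorFunctional_le_integral (hL2 : IsSubspaceL2 H μ)
    (hM : (A : Set (H →L[ℂ] H)) ⊆ multiplierAlgebra H) (g f : H) :
    ‖vectorFunctional A g f‖ ≤ ∫ x, ‖g x‖ * ‖f x‖ ∂μ := by
  simpa using norm_le_integral_norm_of_eq_integral (hL2.integrable_mul g f)
    (hL2.vectorFunctional_eq_integral hM g f)

lemma exists_norm_sub_vectorFunctional_le_of_finset (hL2 : IsSubspaceL2 H μ)
    (hH : ∀ x : X, ∃ f : H, f x ≠ 0) (hA : IsDualAlgebraOfMultipliers A)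
    (hP : IsRestrictionTo P (component A x₀)) (hconst : ¬ IsConstantOnComponent A x₀)
    {R : StrongDual ℂ (OpAlgebra A)} (hR : R ∈ predual A) (hRP : ∀ T, R (P * T) = R T)
    (t : Finset H) {τ : ℝ} (hη0 : 0 < η) (hη1 : η ≤ 1) (hτ : 0 < τ) :
    ∃ a b : H, P a = a ∧ ‖b‖ ≤ ‖a‖ ∧
      ‖R - vectorFunctional A b a‖ + (1 - η) * ‖a‖ ^ 2 ≤ (1 - η ^ 2 / 12) * ‖R‖ ∧
      ∀ h ∈ t, ‖vectorFunctional A h a‖ ≤ τ ∧ ‖vectorFunctional A b h‖ ≤ τ := by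
  have hM := hA.subset_multipliers
  let F : X → ℝ := fun x => ∑ h ∈ t, ‖h x‖
  have hF : MemLp F 2 μ := memLp_finsetSum _ fun h _ => (hL2.memLp h).norm
  have hle : ∀ h ∈ t, ∀ x, ‖h x‖ ≤ F x := fun h hh x =>
    Finset.single_le_sum (f := fun h : H => ‖h x‖) (fun _ _ => norm_nonneg _) hh
  obtain ⟨a, b, hPa, hba, hdrop, hint⟩ := exists_norm_sub_vectorFunctional_le hL2 hH hA hP hconst
    hR hRP hF (fun x => Finset.sum_nonneg fun _ _ => norm_nonneg _) hη0 hη1 hτ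
  refine ⟨a, b, hPa, ?_, hdrop, fun h hh => ⟨?_, ?_⟩⟩
  · simpa using hL2.norm_le_of_norm_apply_le zero_le_one (f := b) (g := a) (by simpa using hba)
  · refine (hL2.norm_vectorFunctional_le_integral hM h a).trans (le_trans ?_ hint)
    simp only [mul_comm ‖h _‖]
    exact hL2.integral_norm_mul_norm_le (fun _ => le_rfl) hF (hle h hh)
  · exact (hL2.norm_vectorFunctional_le_integral hM b h).trans
      ((hL2.integral_norm_mul_norm_le hba hF (hle h hh)).trans hint)

lemma exists_improves (hL2 : IsSubspaceL2 H μ) (hH : ∀ x : X, ∃ f : H, f x ≠ 0)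
    (hA : IsDualAlgebraOfMultipliers A) (hP : IsRestrictionTo P (component A x₀))
    (hconst : ¬ IsConstantOnComponent A x₀) (hL : L ∈ predual A) (hLP : ∀ T, L (P * T) = L T)
    (hp : P p.1 = p.1) (s : Finset X) (hη0 : 0 < η) (hη1 : η < 1) (hκ : 0 < κ) :
    ∃ q : H × H, P q.1 = q.1 ∧ Improves L s η κ p q ∧
      residual L q ≤ (1 - η ^ 2 / 24) * residual L p ∧
      (1 - η) * dist p q ^ 2 ≤ residual L p := by
  classical
  have hM := hA.subset_multipliers
  rcases (norm_nonneg (L - vectorFunctional A p.2 p.1)).eq_or_lt' with h0 | hr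
  · exact ⟨p, hp, Improves.refl L s η κ p, by simp [residual, h0], by simp [residual]⟩
  obtain ⟨f, g⟩ := p
  set R := L - vectorFunctional A g f 
  have hres₀ : residual L (f, g) = ‖R‖ := rfl
  have hRP : ∀ T, R (P * T) = R T := fun T => by
    simp only [R, sub_apply, hLP, vectorFunctional_apply, mul_apply_of_apply_eq hM T hp]
  obtain ⟨τ, hτ, hτη, hτκ⟩ : ∃ τ > 0, 4 * τ ≤ η ^ 2 / 24 * ‖R‖ ∧ τ ≤ κ * (η ^ 2 / 24 * ‖R‖) :=
    ⟨min (1 / 4) κ * (η ^ 2 / 24 * ‖R‖), by positivity, by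
      rw [← mul_assoc]
      exact mul_le_of_le_one_left (by positivity) (by linarith [min_le_left (1 / 4) κ]), by
      gcongr; exact min_le_right _ _⟩
  obtain ⟨a, b, hPa, hba, hdrop, hsmall⟩ := exists_norm_sub_vectorFunctional_le_of_finset hL2 hH
    hA hP hconst ((predual A).sub_mem hL (vectorFunctional_mem_predual A g f)) hRP
    (insert f (insert g (s.image (evalVec H)))) hη0 hη1.le hτ
  have hres : residual L ((f, g) + (a, b)) ≤ ‖R - vectorFunctional A b a‖ + 2 * τ := by
    linarith [residual_add_le L (f, g) (a, b), (hsmall g (by simp)).1, (hsmall f (by simp)).2]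
  have hf : ‖f + a‖ ^ 2 ≤ ‖f‖ ^ 2 + 2 * τ + ‖a‖ ^ 2 := norm_add_sq_le_of_norm_inner_le
    ((norm_inner_le_norm_vectorFunctional f a).trans (hsmall f (by simp)).1)
  have hg : ‖g + b‖ ^ 2 ≤ ‖g‖ ^ 2 + 2 * τ + ‖a‖ ^ 2 := (norm_add_sq_le_of_norm_inner_le
    ((norm_inner_symm g b).trans_le ((norm_inner_le_norm_vectorFunctional b g).trans
      (hsmall g (by simp)).2))).trans (by gcongr)
  have hητ : 0 < η * τ := by positivity
  have hη' : 0 ≤ 1 - η := sub_nonneg.2 hη1.le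
  have ha : 0 ≤ (1 - η) * ‖a‖ ^ 2 := by positivity
  have hdecrease : η ^ 2 / 24 * ‖R‖ ≤ ‖R‖ - residual L ((f, g) + (a, b)) := by linarith
  have hdist : dist (f, g) ((f, g) + (a, b)) = ‖a‖ := by simpa [dist_eq_norm] using hba
  refine ⟨(f, g) + (a, b), by simp [hp, hPa], ⟨?_, ?_, fun y hy => ?_⟩, ?_, ?_⟩
  all_goals rw [hres₀]
  · rw [Prod.fst_add]
    linarith [mul_le_mul_of_nonneg_left hf hη']
  · rw [Prod.snd_add]
    linarith [mul_le_mul_of_nonneg_left hg hη']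
  · rw [Prod.fst_add, RKHS.coe_add, Pi.add_apply, add_sub_cancel_left, ← inner_evalVec]
    exact (norm_inner_le_norm_vectorFunctional _ a).trans
      ((hsmall _ (by simp [Finset.mem_image_of_mem _ hy])).1.trans (hτκ.trans (by gcongr)))
  · linarith
  · rw [hdist]
    nlinarith [norm_nonneg (R - vectorFunctional A b a)]

lemma exists_eq_vectorFunctional_near (hL2 : IsSubspaceL2 H μ) (hH : ∀ x : X, ∃ f : H, f x ≠ 0)
    (hA : IsDualAlgebraOfMultipliers A) (hP : IsRestrictionTo P (component A x₀))
    (hconst : ¬ IsConstantOnComponent A x₀) (hL : L ∈ predual A) (hLP : ∀ T, L (P * T) = L T)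
    {f₀ : H} (hf₀ : P f₀ = f₀) (s : Finset X) (hη0 : 0 < η) (hη1 : η < 1) (hκ : 0 < κ) :
    ∃ f g : H, L = vectorFunctional A g f ∧ (1 - η) * ‖f‖ ^ 2 ≤ (1 - η) * ‖f₀‖ ^ 2 + ‖L‖ ∧
      (1 - η) * ‖g‖ ^ 2 ≤ ‖L‖ ∧ ∀ y ∈ s, ‖f y - f₀ y‖ ≤ κ * ‖L‖ := by
  have hη' : 0 < 1 - η := sub_pos.2 hη1
  have hP_closed : IsClosed {q : H × H | P q.1 = q.1} :=
    isClosed_eq (by fun_prop) (by fun_prop)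
  obtain ⟨q, ⟨-, hq⟩, hq0⟩ := exists_mem_eq_zero_of_forall_exists_le (C := (1 - η)⁻¹)
    (S := {q | P q.1 = q.1} ∩ {q | Improves L s η κ (f₀, 0) q}) (continuous_residual L)
    (fun p => norm_nonneg _) (hP_closed.inter (isClosed_setOf_improves L s η κ (f₀, 0)))
    ⟨(f₀, 0), hf₀, Improves.refl L s η κ (f₀, 0)⟩ (ρ := 1 - η ^ 2 / 24) (by nlinarith)
    (by nlinarith) fun p ⟨hPp, hp⟩ => by
      obtain ⟨q, hPq, hq, hres, hdist⟩ :=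
        exists_improves hL2 hH hA hP hconst hL hLP hPp s hη0 hη1 hκ
      exact ⟨q, ⟨hPq, hp.trans hq⟩, hres, (le_inv_mul_iff₀ hη').2 hdist⟩
  have hres₀ : residual L (f₀, 0) = ‖L‖ := by simp [residual]
  refine ⟨q.1, q.2, sub_eq_zero.1 (norm_eq_zero.1 hq0), ?_, ?_, fun y hy => ?_⟩
  · simpa [hq0, hres₀] using hq.norm_fst
  · simpa [hq0, hres₀] using hq.norm_snd
  · simpa [hq0, hres₀] using hq.norm_sub_apply y hy

end Factorization

section PointEvaluations

variable {X H : Type*} [NormedAddCommGroup H] [InnerProductSpace ℂ H] [CompleteSpace H]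
  [RKHS ℂ H X ℂ] {A : Subalgebra ℂ (H →L[ℂ] H)} {P : OpAlgebra A} {E : Set X} {x₀ : X}
  {L : StrongDual ℂ (OpAlgebra A)}

lemma exists_forall_apply_ne_zero (hM : (A : Set (H →L[ℂ] H)) ⊆ multiplierAlgebra H)
    (hH : ∀ x : X, ∃ f : H, f x ≠ 0) (hP : IsRestrictionTo P E) {s : Finset X}
    (hs : ∀ y ∈ s, y ∈ E) : ∃ f : H, P f = f ∧ ∀ y ∈ s, f y ≠ 0 := by
  obtain ⟨f, hf⟩ := Module.Dual.exists_forall_ne_zero_of_forall_exists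
    (fun y : s => (LinearMap.proj (y : X)).comp (RKHS.coeCLM ℂ (H := H)).toLinearMap)
    fun y => hH y
  refine ⟨P f, by simpa using hP.apply_mul_apply hM 1 f, fun y hy => ?_⟩
  rw [apply_eq_symbol_mul hM, hP, Set.indicator_of_mem (hs y hy), Pi.one_apply, one_mul]
  exact hf ⟨y, hy⟩

lemma IsConstantOnComponent.exists_evalFunctional_eq_vectorFunctional
    (hM : (A : Set (H →L[ℂ] H)) ⊆ multiplierAlgebra H) (hconst : IsConstantOnComponent A x₀)
    (hP : IsRestrictionTo P (component A x₀)) {f : H} (hf : P f = f) (hf0 : f ≠ 0) :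
    ∃ g : H, evalFunctional A x₀ = vectorFunctional A g f ∧ ‖f‖ * ‖g‖ = 1 := by
  have hTf : ∀ T : OpAlgebra A, T f = symbol T x₀ • f := fun T => RKHS.ext fun y => by
    rw [apply_eq_symbol_mul hM, RKHS.coe_smul, Pi.smul_apply, smul_eq_mul]
    by_cases hy : y ∈ component A x₀
    · rw [hconst _ (symbol_mem_symbols hM T) y hy]
    · rw [hP.apply_eq_zero hM hf hy, mul_zero, mul_zero]
  have hfn : (‖f‖ : ℂ) ≠ 0 := by simpa using hf0
  refine ⟨((‖f‖ : ℂ) ^ 2)⁻¹ • f, ContinuousLinearMap.ext fun T => ?_, ?_⟩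
  · rw [evalFunctional_apply, vectorFunctional_apply, hTf, inner_smul_left, inner_smul_right,
      inner_self_eq_norm_sq_to_K]
    simp only [map_inv₀, map_pow, Complex.conj_ofReal, Complex.coe_algebraMap]
    field_simp
  · have hfn' : ‖f‖ ≠ 0 := norm_ne_zero_iff.2 hf0
    rw [norm_smul, norm_inv, norm_pow, Complex.norm_real, norm_norm]
    field_simp

variable [MeasurableSpace X] {μ : Measure X}

lemma exists_eq_vectorFunctional_of_not_isConstantOnComponent (hL2 : IsSubspaceL2 H μ)
    (hH : ∀ x : X, ∃ f : H, f x ≠ 0) (hA : IsDualAlgebraOfMultipliers A)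
    (hP : IsRestrictionTo P (component A x₀)) (hconst : ¬ IsConstantOnComponent A x₀)
    (hL : L ∈ predual A) (hLP : ∀ T, L (P * T) = L T) {f₀ : H} (hf₀ : P f₀ = f₀) {s : Finset X}
    (hs : ∀ y ∈ s, f₀ y ≠ 0) {r : ℝ} (hr : ‖L‖ < r) :
    ∃ f g : H, L = vectorFunctional A g f ∧ ‖f‖ * ‖g‖ ≤ r ∧ ∀ y ∈ s, f y ≠ 0 := by
  have hη : ∀ᶠ η : ℝ in 𝓝[>] 0, η / 2 * ‖f₀‖ ^ 2 + ‖L‖ / (1 - η) < r ∧ η < 1 := by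
    refine nhdsWithin_le_nhds ((Tendsto.eventually_lt_const (v := ‖L‖) hr ?_).and
      (eventually_lt_nhds one_pos))
    have : ContinuousAt (fun η : ℝ => η / 2 * ‖f₀‖ ^ 2 + ‖L‖ / (1 - η)) 0 := by
      fun_prop (disch := norm_num)
    simpa [ContinuousAt] using this
  obtain ⟨η, ⟨hηr, hη1⟩, hη0⟩ := (hη.and self_mem_nhdsWithin).exists
  have hη0 : 0 < η := hη0
  have hκ : ∀ᶠ κ : ℝ in 𝓝[>] 0, ∀ y ∈ s, κ * ‖L‖ < ‖((√η : ℂ) • f₀) y‖ := by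
    refine nhdsWithin_le_nhds ((eventually_all_finset s).2 fun y hy => ?_)
    refine Tendsto.eventually_lt_const (v := 0) ?_
      (by simpa using (continuous_mul_const ‖L‖).tendsto (0 : ℝ))
    rw [norm_pos_iff, RKHS.coe_smul, Pi.smul_apply]
    exact smul_ne_zero (by exact_mod_cast (Real.sqrt_pos.2 hη0).ne') (hs y hy)
  obtain ⟨κ, hκs, hκ0⟩ := (hκ.and self_mem_nhdsWithin).exists
  obtain ⟨f, g, hfg, hf, hg, hfs⟩ := exists_eq_vectorFunctional_near hL2 hH hA hP hconst hL hLP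
    (f₀ := (√η : ℂ) • f₀) (by rw [map_smul, hf₀]) s hη0 hη1 hκ0
  refine ⟨f, g, hfg, ?_, fun y hy hfy => ?_⟩
  · have hη' : 0 < 1 - η := sub_pos.2 hη1
    have hnorm : ‖(√η : ℂ) • f₀‖ ^ 2 = η * ‖f₀‖ ^ 2 := by
      rw [norm_smul, mul_pow, Complex.norm_real, Real.norm_of_nonneg (Real.sqrt_nonneg η),
        Real.sq_sqrt hη0.le]
    have hf' : ‖f‖ ^ 2 ≤ η * ‖f₀‖ ^ 2 + ‖L‖ / (1 - η) := by
      rwa [← mul_le_mul_iff_right₀ hη', mul_add, mul_div_cancel₀ _ hη'.ne', ← hnorm]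
    have hg' : ‖g‖ ^ 2 ≤ ‖L‖ / (1 - η) := (le_div_iff₀' hη').2 hg
    linarith [two_mul_le_add_sq ‖f‖ ‖g‖]
  · have := hfs y hy
    rw [hfy, zero_sub, norm_neg] at this
    exact (hκs y hy).not_ge this

lemma exists_sum_smul_evalFunctional_eq_vectorFunctional (hL2 : IsSubspaceL2 H μ)
    (hH : ∀ x : X, ∃ f : H, f x ≠ 0) (hA : IsDualAlgebraOfMultipliers A) {ι : Type*} [Fintype ι]
    {x : ι → X} (hx : ∀ i, x i ∈ component A x₀) (c : ι → ℂ) {r : ℝ}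
    (hr : ‖∑ i, c i • evalFunctional A (x i)‖ < r) :
    ∃ f g : H, ∑ i, c i • evalFunctional A (x i) = vectorFunctional A g f ∧ ‖f‖ * ‖g‖ ≤ r ∧
      ∀ i, f (x i) ≠ 0 := by
  classical
  have hM := hA.subset_multipliers
  obtain ⟨P, hP : IsRestrictionTo P (component A x₀)⟩ :=
    exists_symbol_eq hH (isClopenFor_component hL2 hH hA x₀)
  set L := ∑ i, c i • evalFunctional A (x i)
  obtain ⟨f₀, hPf₀, hf₀⟩ := exists_forall_apply_ne_zero hM hH hP
    (s := insert x₀ (Finset.univ.image x)) (by simpa using ⟨mem_component_self A x₀, hx⟩)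
  by_cases hconst : IsConstantOnComponent A x₀
  · have hL : L = (∑ i, c i) • evalFunctional A x₀ := ContinuousLinearMap.ext fun T => by
      have hT : ∀ i, symbol T (x i) = symbol T x₀ := fun i =>
        hconst _ (symbol_mem_symbols hM T) _ (hx i)
      simp [L, hT, Finset.sum_mul]
    have hf₀0 : f₀ ≠ 0 := fun h => hf₀ x₀ (by simp) (by simp [h])
    obtain ⟨g, hg, hnorm⟩ :=
      hconst.exists_evalFunctional_eq_vectorFunctional hM hP hPf₀ hf₀0
    refine ⟨f₀, conj (∑ i, c i) • g, ?_, le_of_eq_of_le ?_ hr.le, fun i => hf₀ _ (by simp)⟩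
    · rw [hL, hg, map_smulₛₗ, Complex.conj_conj, smul_apply]
    · rw [norm_smul, RCLike.norm_conj, mul_left_comm, hnorm, hL, norm_smul,
        norm_evalFunctional hH]
  · have hLP : ∀ T, L (P * T) = L T := fun T => by
      simp [L, hP.symbol_mul_of_mem hM T (hx _)]
    obtain ⟨f, g, hfg, hnorm, hf⟩ := exists_eq_vectorFunctional_of_not_isConstantOnComponent hL2
      hH hA hP hconst (Submodule.sum_mem _ fun i _ => Submodule.smul_mem _ _
        (evalFunctional_mem_predual (x i))) hLP hPf₀ hf₀ hr
    exact ⟨f, g, hfg, hnorm, fun i => hf _ (by simp)⟩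

end PointEvaluations

section PickMatrix

lemma posSemidef_of_forall_finset {ι R : Type*} [Ring R] [PartialOrder R] [StarRing R]
    {M : Matrix ι ι R}
    (h : ∀ s : Finset ι, (M.submatrix ((↑) : s → ι) ((↑) : s → ι)).PosSemidef) :
    M.PosSemidef := by
  classical
  refine ⟨Matrix.IsHermitian.ext fun i j => ?_, fun z => ?_⟩
  · exact (h {i, j}).isHermitian.apply ⟨i, by simp⟩ ⟨j, by simp⟩
  · have hsub : ∀ F : ι → R → R, (z.subtypeDomain (· ∈ z.support)).sum (fun i => F i) = z.sum F :=
      fun F => Finsupp.sum_subtypeDomain_index fun _ hi => hi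
    refine ((h z.support).2 (z.subtypeDomain (· ∈ z.support))).trans_eq ?_
    simp only [Matrix.submatrix_apply]
    rw [← hsub]
    exact Finsupp.sum_congr fun i _ => hsub fun j c => star (z i) * M i j * c

variable {V E : Type*} [AddCommGroup V] [Module ℂ V] [NormedAddCommGroup E]
  [InnerProductSpace ℂ E]

lemma exists_mem_closure_range_inner_eq [CompleteSpace E] (τ : V →ₗ[ℂ] E) (ℓ : V →ₗ[ℂ] ℂ) {C : ℝ}
    (h : ∀ v, ‖ℓ v‖ ≤ C * ‖τ v‖) :
    ∃ G ∈ (LinearMap.range τ).topologicalClosure, ∀ v, inner ℂ G (τ v) = ℓ v := by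
  let W := (LinearMap.range τ).topologicalClosure
  have : CompleteSpace W := (Submodule.isClosed_topologicalClosure _).completeSpace_coe
  have hle : LinearMap.range τ ≤ W := Submodule.le_topologicalClosure _
  let e : V →ₗ[ℂ] W := (Submodule.inclusion hle).comp τ.rangeRestrict
  have he : DenseRange e := (denseRange_inclusion_iff hle).2 subset_rfl |>.comp
    τ.surjective_rangeRestrict.denseRange (continuous_inclusion hle)
  refine ⟨(InnerProductSpace.toDual ℂ W).symm (ℓ.extendOfNorm e), Subtype.property _, fun v => ?_⟩
  have hG : inner ℂ ((InnerProductSpace.toDual ℂ W).symm (ℓ.extendOfNorm e)) (e v) = ℓ v := by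
    rw [InnerProductSpace.toDual_symm_apply, LinearMap.extendOfNorm_eq he ⟨C, h⟩]
  exact hG

lemma norm_le_of_mem_topologicalClosure {K : Submodule ℂ E} {G : E} {C : ℝ} (hC : 0 ≤ C)
    (hG : G ∈ K.topologicalClosure) (h : ∀ y ∈ K, ‖inner ℂ G y‖ ≤ C * ‖y‖) : ‖G‖ ≤ C := by
  have hGG : ‖inner ℂ G G‖ ≤ C * ‖G‖ :=
    closure_minimal (t := {y | ‖inner ℂ G y‖ ≤ C * ‖y‖}) h
      (isClosed_le (by fun_prop) (by fun_prop)) hG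
  rw [← inner_self_re_eq_norm, inner_self_eq_norm_mul_norm] at hGG
  rcases (norm_nonneg G).eq_or_lt with h0 | h0
  · rwa [← h0]
  · exact le_of_mul_le_mul_right hGG h0

/-- The Pick matrix of the kernel `K` for the nodes `x` and the target values `w`. -/
def pickMatrix {ι X : Type*} (K : X → X → ℂ) (x : ι → X) (w : ι → ℂ) : Matrix ι ι ℂ :=
  Matrix.of fun i j => (1 - w i * conj (w j)) * K (x i) (x j)

variable {ι X : Type*} [Fintype ι]

lemma norm_sum_smul_sq (k : ι → E) (a : ι → ℂ) :
    ((‖∑ i, a i • k i‖ ^ 2 : ℝ) : ℂ) = ∑ i, ∑ j, conj (a i) * a j * inner ℂ (k i) (k j) := by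
  have h := inner_self_eq_norm_sq_to_K (𝕜 := ℂ) (∑ i, a i • k i)
  rw [sum_inner] at h
  push_cast
  rw [← Complex.coe_algebraMap, ← h]
  refine Finset.sum_congr rfl fun i _ => ?_
  rw [inner_sum]
  exact Finset.sum_congr rfl fun j _ => by rw [inner_smul_left, inner_smul_right, mul_assoc]

lemma star_dotProduct_pickMatrix_mulVec (k : X → E) (x : ι → X) (w z : ι → ℂ) :
    star z ⬝ᵥ (pickMatrix (fun y y' => inner ℂ (k y) (k y')) x w).mulVec z =
      ((‖∑ i, z i • k (x i)‖ ^ 2 - ‖∑ i, (conj (w i) * z i) • k (x i)‖ ^ 2 : ℝ) : ℂ) := by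
  rw [Complex.ofReal_sub, norm_sum_smul_sq, norm_sum_smul_sq, ← Finset.sum_sub_distrib]
  refine Finset.sum_congr rfl fun i _ => ?_
  rw [Matrix.mulVec, dotProduct, Finset.mul_sum, ← Finset.sum_sub_distrib]
  refine Finset.sum_congr rfl fun j _ => ?_
  simp only [pickMatrix, Matrix.of_apply, Pi.star_apply, RCLike.star_def, map_mul,
    Complex.conj_conj]
  ring

lemma posSemidef_pickMatrix_iff (k : X → E) (x : ι → X) (w : ι → ℂ) :
    (pickMatrix (fun y y' => inner ℂ (k y) (k y')) x w).PosSemidef ↔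
      ∀ z : ι → ℂ, ‖∑ i, (conj (w i) * z i) • k (x i)‖ ≤ ‖∑ i, z i • k (x i)‖ := by
  have hherm : (pickMatrix (fun y y' => inner ℂ (k y) (k y')) x w).IsHermitian := by
    ext i j
    simp [pickMatrix, mul_comm]
  rw [Matrix.posSemidef_iff_dotProduct_mulVec, and_iff_right hherm]
  refine forall_congr' fun z => ?_
  rw [star_dotProduct_pickMatrix_mulVec, Complex.zero_le_real, sub_nonneg,
    pow_le_pow_iff_left₀ (norm_nonneg _) (norm_nonneg _) two_ne_zero]

end PickMatrix

section WeightedL2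

variable {X H : Type*} [MeasurableSpace X] {μ : Measure X} [NormedAddCommGroup H]
  [InnerProductSpace ℂ H] [RKHS ℂ H X ℂ] {A : Subalgebra ℂ (H →L[ℂ] H)}

lemma IsMulOp.eLpNorm_absSqMeasure (hL2 : IsSubspaceL2 H μ) {T : H →L[ℂ] H} {φ : X → ℂ}
    (hT : IsMulOp T φ) (f : H) : eLpNorm φ 2 (absSqMeasure f μ) = ‖T f‖ₑ := by
  rw [← (hL2 (T f)).2, eLpNorm_eq_lintegral_rpow_enorm_toReal two_ne_zero ENNReal.ofNat_ne_top,
    eLpNorm_eq_lintegral_rpow_enorm_toReal two_ne_zero ENNReal.ofNat_ne_top, absSqMeasure,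
    lintegral_withDensity_eq_lintegral_mul_non_measurable₀ _ ((hL2.memLp f).1.enorm.pow_const 2)
      (.of_forall fun x => by finiteness)]
  congr 2
  funext x
  simp only [Pi.mul_apply, ENNReal.toReal_ofNat, ENNReal.rpow_ofNat]
  rw [hT, enorm_mul, mul_pow, mul_comm]

lemma IsMulOp.memLp_absSqMeasure (hL2 : IsSubspaceL2 H μ) {T : H →L[ℂ] H} {φ : X → ℂ}
    (hT : IsMulOp T φ) (f : H) : MemLp φ 2 (absSqMeasure f μ) := by
  refine ⟨?_, by rw [hT.eLpNorm_absSqMeasure hL2]; finiteness⟩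
  have hac : absSqMeasure f μ ≪ μ := withDensity_absolutelyContinuous _ _
  have hne : ∀ᵐ x ∂absSqMeasure f μ, f x ≠ 0 := by
    rw [absSqMeasure, ae_withDensity_iff' ((hL2.memLp f).1.enorm.pow_const 2)]
    exact .of_forall fun x hx h0 => hx (by simp [h0])
  have hquot : AEMeasurable (fun x => T f x / f x) (absSqMeasure f μ) :=
    ((hL2.memLp (T f)).1.aemeasurable.div (hL2.memLp f).1.aemeasurable).mono_ac hac
  refine (hquot.congr ?_).aestronglyMeasurable
  filter_upwards [hne] with x hx
  rw [hT, mul_div_cancel_right₀ _ hx]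

lemma kernelVec_eq_zero_or_isReproducingAt (S : Set (X → ℂ)) (ν : Measure X) (x : X) :
    kernelVec S ν x = 0 ∨ IsReproducingAt S ν x (kernelVec S ν x) := by
  rw [kernelVec]
  split_ifs with h
  · exact Or.inr h.choose_spec
  · exact Or.inl rfl

variable [CompleteSpace H]

/-- The map `M_φ ↦ φ` from `A` to `L²(|f|²μ)`. -/
def toWeightedL2 (hL2 : IsSubspaceL2 H μ) (hM : (A : Set (H →L[ℂ] H)) ⊆ multiplierAlgebra H)
    (f : H) : OpAlgebra A →ₗ[ℂ] Lp ℂ 2 (absSqMeasure f μ) where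
  toFun T := (IsMulOp.memLp_absSqMeasure hL2 (apply_eq_symbol_mul hM T) f).toLp (symbol T)
  map_add' S T := by
    rw [← MemLp.toLp_add]
    exact MemLp.toLp_congr _ _ (.of_forall fun x => by simp [symbol, add_div])
  map_smul' c T := by
    rw [RingHom.id_apply, ← MemLp.toLp_const_smul]
    exact MemLp.toLp_congr _ _ (.of_forall fun x => by simp [symbol_smul_apply])

lemma norm_toWeightedL2 (hL2 : IsSubspaceL2 H μ)
    (hM : (A : Set (H →L[ℂ] H)) ⊆ multiplierAlgebra H) (f : H) (T : OpAlgebra A) :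
    ‖toWeightedL2 hL2 hM f T‖ = ‖T f‖ := by
  change ‖(IsMulOp.memLp_absSqMeasure hL2 (apply_eq_symbol_mul hM T) f).toLp (symbol T)‖ = _
  rw [Lp.norm_toLp, IsMulOp.eLpNorm_absSqMeasure hL2 (apply_eq_symbol_mul hM T), toReal_enorm]

lemma closureL2_symbols (hL2 : IsSubspaceL2 H μ) (hH : ∀ x : X, ∃ f : H, f x ≠ 0)
    (hM : (A : Set (H →L[ℂ] H)) ⊆ multiplierAlgebra H) (f : H) :
    closureL2 (symbols A) (absSqMeasure f μ) =
      (LinearMap.range (toWeightedL2 hL2 hM f)).topologicalClosure := by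
  have hrange : {g | ∃ φ ∈ symbols A, ∃ h : MemLp φ 2 (absSqMeasure f μ), h.toLp φ = g} =
      (LinearMap.range (toWeightedL2 hL2 hM f) : Set (Lp ℂ 2 (absSqMeasure f μ))) := by
    ext g
    constructor
    · rintro ⟨φ, hφ, h, rfl⟩
      obtain ⟨T, rfl⟩ := exists_symbol_eq hH hφ
      exact ⟨T, rfl⟩
    · rintro ⟨T, rfl⟩
      exact ⟨symbol T, symbol_mem_symbols hM T,
        IsMulOp.memLp_absSqMeasure hL2 (apply_eq_symbol_mul hM T) f, rfl⟩
  rw [closureL2, hrange, Submodule.span_eq]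

lemma isReproducingAt_iff (hL2 : IsSubspaceL2 H μ) (hH : ∀ x : X, ∃ f : H, f x ≠ 0)
    (hM : (A : Set (H →L[ℂ] H)) ⊆ multiplierAlgebra H) (f : H) (x : X)
    (k : Lp ℂ 2 (absSqMeasure f μ)) :
    IsReproducingAt (symbols A) (absSqMeasure f μ) x k ↔
      k ∈ (LinearMap.range (toWeightedL2 hL2 hM f)).topologicalClosure ∧
        ∀ T, inner ℂ k (toWeightedL2 hL2 hM f T) = symbol T x := by
  rw [IsReproducingAt, closureL2_symbols hL2 hH hM]
  refine and_congr_right fun _ => ⟨fun h T => h _ (symbol_mem_symbols hM T)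
    (IsMulOp.memLp_absSqMeasure hL2 (apply_eq_symbol_mul hM T) f), ?_⟩
  rintro h φ hφ _
  obtain ⟨T, rfl⟩ := exists_symbol_eq hH hφ
  exact h T

lemma isReproducingAt_kernelVec (hL2 : IsSubspaceL2 H μ) (hH : ∀ x : X, ∃ f : H, f x ≠ 0)
    (hM : (A : Set (H →L[ℂ] H)) ⊆ multiplierAlgebra H) {f : H} {x : X} (hx : f x ≠ 0) :
    IsReproducingAt (symbols A) (absSqMeasure f μ) x
      (kernelVec (symbols A) (absSqMeasure f μ) x) := by
  have hbound : ∀ T : OpAlgebra A,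
      ‖evalFunctional A x T‖ ≤ ‖evalVec H x‖ / ‖f x‖ * ‖toWeightedL2 hL2 hM f T‖ := fun T => by
    rw [norm_toWeightedL2, evalFunctional_apply, div_mul_eq_mul_div,
      le_div_iff₀ (norm_pos_iff.2 hx), ← norm_mul, ← apply_eq_symbol_mul hM, ← inner_evalVec]
    exact norm_inner_le_norm _ _
  obtain ⟨k, hk, hkT⟩ := exists_mem_closure_range_inner_eq (toWeightedL2 hL2 hM f)
    (evalFunctional A x).toLinearMap hbound
  have h : ∃ k, IsReproducingAt (symbols A) (absSqMeasure f μ) x k :=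
    ⟨k, (isReproducingAt_iff hL2 hH hM f x k).2
      ⟨hk, fun T => (hkT T).trans (evalFunctional_apply x T)⟩⟩
  rw [kernelVec, dif_pos h]
  exact h.choose_spec

end WeightedL2

section SymbolBall

variable {X H : Type*} [NormedAddCommGroup H] [InnerProductSpace ℂ H] [RKHS ℂ H X ℂ]

lemma convex_symbolBall (A : Subalgebra ℂ (H →L[ℂ] H)) :
    Convex ℝ (symbolBall A : Set (X → ℂ)) := by
  have hball : Convex ℝ {φ : X → ℂ | ∀ y, ‖φ y‖ ≤ 1} := by
    simpa [Set.pi] using convex_pi (s := Set.univ) fun (_ : X) _ =>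
      convex_closedBall (0 : ℂ) 1
  exact ((symbolAlgebra A).toSubmodule.restrictScalars ℝ).convex.inter hball

open Classical in
lemma IsClopenFor.piecewise_mem_symbolBall {A : Subalgebra ℂ (H →L[ℂ] H)} {E : Set X}
    (hE : IsClopenFor A E) {φ ψ : X → ℂ} (hφ : φ ∈ symbolBall A) (hψ : ψ ∈ symbolBall A) :
    E.piecewise φ ψ ∈ symbolBall A := by
  have hsum : E.piecewise φ ψ = E.indicator 1 * (φ - ψ) + ψ := by
    funext y
    by_cases hy : y ∈ E <;> simp [hy]
  refine ⟨?_, fun y => ?_⟩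
  · rw [hsum]
    exact (symbolAlgebra A).add_mem (mul_mem hE (sub_mem hφ.1 hψ.1)) hψ.1
  · by_cases hy : y ∈ E
    · simpa [hy] using hφ.2 y
    · simpa [hy] using hψ.2 y

lemma norm_le_of_forall_re_apply_le {E : Type*} [SeminormedAddCommGroup E] [NormedSpace ℂ E]
    {L : StrongDual ℂ E} {C : ℝ} (h : ∀ v, ‖v‖ ≤ 1 → (L v).re ≤ C) : ‖L‖ ≤ C := by
  refine ContinuousLinearMap.opNorm_le_of_unit_norm (by simpa using h 0) fun v hv => ?_
  obtain ⟨c, hc, hcv⟩ := RCLike.exists_norm_eq_mul_self (L v)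
  simpa [← hcv] using h (c • v) (by rw [norm_smul, hc, hv, one_mul])

end SymbolBall

section Interpolation

variable {X H : Type*} [MeasurableSpace X] {μ : Measure X} [NormedAddCommGroup H]
  [InnerProductSpace ℂ H] [CompleteSpace H] [RKHS ℂ H X ℂ] {A : Subalgebra ℂ (H →L[ℂ] H)}
  {ι : Type*}

lemma posSemidef_pickMatrix_of_mem_symbolBall (hL2 : IsSubspaceL2 H μ)
    (hH : ∀ x : X, ∃ f : H, f x ≠ 0) (hM : (A : Set (H →L[ℂ] H)) ⊆ multiplierAlgebra H)
    (x : ι → X) {φ : X → ℂ} (hφ : φ ∈ symbolBall A) (f : H) :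
    (pickMatrix (kernelFn (symbols A) (absSqMeasure f μ)) x fun i => φ (x i)).PosSemidef := by
  obtain ⟨hφA, hφ1⟩ := hφ
  obtain ⟨S, rfl⟩ := exists_symbol_eq hH hφA
  refine posSemidef_of_forall_finset fun s => ?_
  set k := kernelVec (symbols A) (absSqMeasure f μ)
  refine (posSemidef_pickMatrix_iff k (fun i : s => x i) _).2 fun z => ?_
  have hk := fun i : s => kernelVec_eq_zero_or_isReproducingAt (symbols A) (absSqMeasure f μ) (x i)
  simp only [isReproducingAt_iff hL2 hH hM] at hk
  have hST : ∀ (i : s) T, inner ℂ (k (x i)) (toWeightedL2 hL2 hM f (S * T)) =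
      symbol S (x i) * inner ℂ (k (x i)) (toWeightedL2 hL2 hM f T) := fun i T => by
    rcases hk i with h | ⟨-, h⟩
    · simp [k, h]
    · rw [h, h, symbol_mul_apply hM]
  refine norm_le_of_mem_topologicalClosure (K := LinearMap.range (toWeightedL2 hL2 hM f))
    (norm_nonneg _) (Submodule.sum_mem _ fun i _ => Submodule.smul_mem _ _ ?_) ?_
  · exact (hk i).elim (fun h => by rw [show k (x i) = 0 from h]; exact zero_mem _) And.left
  · rintro _ ⟨T, rfl⟩
    have hmove :
        inner ℂ (∑ i : s, (conj (symbol S (x i)) * z i) • k (x i)) (toWeightedL2 hL2 hM f T) =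
          inner ℂ (∑ i : s, z i • k (x i)) (toWeightedL2 hL2 hM f (S * T)) := by
      simp only [sum_inner, inner_smul_left, hST, map_mul, Complex.conj_conj]
      exact Finset.sum_congr rfl fun i _ => by ring
    rw [hmove]
    refine (norm_inner_le_norm _ _).trans ?_
    gcongr
    rw [norm_toWeightedL2, norm_toWeightedL2]
    refine (hL2.norm_le_of_norm_apply_le zero_le_one fun y => ?_).trans_eq (one_mul _)
    rw [map_mul, mul_apply_eq_comp, apply_eq_symbol_mul hM S, norm_mul]
    gcongr
    exact hφ1 y

lemma norm_sum_mul_le_of_posSemidef [Fintype ι] (hL2 : IsSubspaceL2 H μ)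
    (hH : ∀ x : X, ∃ f : H, f x ≠ 0)
    (hM : (A : Set (H →L[ℂ] H)) ⊆ multiplierAlgebra H) {x : ι → X} {w c : ι → ℂ} {f g : H}
    (hf : ∀ i, f (x i) ≠ 0)
    (hfg : ∑ i, c i • evalFunctional A (x i) = vectorFunctional A g f)
    (hpos : (pickMatrix (kernelFn (symbols A) (absSqMeasure f μ)) x w).PosSemidef) :
    ‖∑ i, c i * w i‖ ≤ ‖f‖ * ‖g‖ := by
  set k := kernelVec (symbols A) (absSqMeasure f μ)
  have hk := fun i => (isReproducingAt_iff hL2 hH hM f (x i) (k (x i))).1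
    (isReproducingAt_kernelVec hL2 hH hM (hf i))
  have hinner : ∀ (a : ι → ℂ) (T : OpAlgebra A),
      inner ℂ (∑ i, conj (a i) • k (x i)) (toWeightedL2 hL2 hM f T) =
        ∑ i, a i * symbol T (x i) := fun a T => by
    simp [sum_inner, inner_smul_left, (hk _).2]
  have hg : ‖∑ i, conj (c i) • k (x i)‖ ≤ ‖g‖ := by
    refine norm_le_of_mem_topologicalClosure (K := LinearMap.range (toWeightedL2 hL2 hM f))
      (norm_nonneg _) (Submodule.sum_mem _ fun i _ => Submodule.smul_mem _ _ (hk i).1) ?_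
    rintro _ ⟨T, rfl⟩
    have hT : ∑ i, c i * symbol T (x i) = inner ℂ g (T f) := by
      simpa using DFunLike.congr_fun hfg T
    rw [hinner, hT, norm_toWeightedL2]
    exact norm_inner_le_norm _ _
  calc ‖∑ i, c i * w i‖
      = ‖inner ℂ (∑ i, conj (w i * c i) • k (x i)) (toWeightedL2 hL2 hM f 1)‖ := by
        rw [hinner fun i => w i * c i]
        simp [symbol_one hH, mul_comm]
    _ ≤ ‖∑ i, conj (w i * c i) • k (x i)‖ * ‖toWeightedL2 hL2 hM f 1‖ := norm_inner_le_norm _ _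
    _ ≤ ‖g‖ * ‖f‖ := by
        rw [norm_toWeightedL2, map_one, one_apply_eq_self]
        gcongr
        simpa using ((posSemidef_pickMatrix_iff k x w).1 hpos fun i => conj (c i)).trans hg
    _ = ‖f‖ * ‖g‖ := mul_comm _ _

lemma exists_mem_symbolBall_of_mem_component [Finite ι] (hL2 : IsSubspaceL2 H μ)
    (hH : ∀ x : X, ∃ f : H, f x ≠ 0) (hA : IsDualAlgebraOfMultipliers A) {x₀ : X} {x : ι → X}
    (hx : ∀ i, x i ∈ component A x₀) {w : ι → ℂ}
    (hpos : ∀ f : H,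
      (pickMatrix (kernelFn (symbols A) (absSqMeasure f μ)) x w).PosSemidef) :
    ∃ φ ∈ symbolBall A, ∀ i, φ (x i) = w i := by
  classical
  cases nonempty_fintype ι
  have hM := hA.subset_multipliers
  suffices h : w ∈ LinearMap.funLeft ℝ ℂ x '' symbolBall A by
    obtain ⟨φ, hφ, rfl⟩ := h
    exact ⟨φ, hφ, fun i => rfl⟩
  by_contra hw
  have hcompact : IsCompact (LinearMap.funLeft ℝ ℂ x '' symbolBall A) :=
    (isCompact_symbolBall hL2 hH hA).image
      (continuous_pi fun i => continuous_apply (x i))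
  obtain ⟨ℓ, N, hN, hNw⟩ := RCLike.geometric_hahn_banach_closed_point (𝕜 := ℂ)
    ((convex_symbolBall A).linear_image _) hcompact.isClosed hw
  let c : ι → ℂ := fun i => ℓ fun j => if i = j then 1 else 0
  have hℓ : ∀ v : ι → ℂ, ℓ v = ∑ i, c i * v i := fun v =>
    (LinearMap.pi_apply_eq_sum_univ ℓ.toLinearMap v).trans
      (Finset.sum_congr rfl fun i _ => mul_comm _ _)
  have hL : ‖∑ i, c i • evalFunctional A (x i)‖ ≤ N :=
    norm_le_of_forall_re_apply_le fun T hT => by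
      have hTN := hN _ ⟨symbol T, ⟨symbol_mem_symbols hM T, fun y =>
        (norm_symbol_le T y).trans hT⟩, rfl⟩
      rw [hℓ] at hTN
      simpa using hTN.le
  have hbound : ‖∑ i, c i * w i‖ ≤ N := le_of_forall_gt_imp_ge_of_dense fun r hr => by
    obtain ⟨f, g, hfg, hnorm, hf⟩ :=
      exists_sum_smul_evalFunctional_eq_vectorFunctional hL2 hH hA hx c (hL.trans_lt hr)
    exact (norm_sum_mul_le_of_posSemidef hL2 hH hM hf hfg (hpos f)).trans hnorm
  rw [hℓ] at hNw
  exact (hNw.trans_le (RCLike.re_le_norm _)).not_ge hbound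

lemma exists_mem_symbolBall_of_forall_finset (hL2 : IsSubspaceL2 H μ)
    (hH : ∀ x : X, ∃ f : H, f x ≠ 0) (hA : IsDualAlgebraOfMultipliers A) {x : ι → X} {w : ι → ℂ}
    (h : ∀ s : Finset ι, ∃ φ ∈ symbolBall A, ∀ i ∈ s, φ (x i) = w i) :
    ∃ φ ∈ symbolBall A, ∀ i, φ (x i) = w i := by
  obtain ⟨φ, hφ, hφw⟩ := (isCompact_symbolBall hL2 hH hA).inter_iInter_nonempty
    (fun i => {φ : X → ℂ | φ (x i) = w i})
    (fun i => isClosed_eq (continuous_apply (x i)) continuous_const) fun s => by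
      obtain ⟨φ, hφ, hφs⟩ := h s
      exact ⟨φ, hφ, Set.mem_iInter₂.2 hφs⟩
  exact ⟨φ, hφ, Set.mem_iInter.1 hφw⟩

lemma exists_mem_symbolBall_of_forall_component (hL2 : IsSubspaceL2 H μ)
    (hH : ∀ x : X, ∃ f : H, f x ≠ 0) (hA : IsDualAlgebraOfMultipliers A) {x : ι → X} {w : ι → ℂ}
    (h : ∀ j, ∃ φ ∈ symbolBall A, ∀ i, x i ∈ component A (x j) → φ (x i) = w i) :
    ∃ φ ∈ symbolBall A, ∀ i, φ (x i) = w i := by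
  classical
  refine exists_mem_symbolBall_of_forall_finset hL2 hH hA fun s => ?_
  induction s using Finset.induction_on with
  | empty => exact ⟨_, (isClopenFor_univ A).indicator_mem_symbolBall, by simp⟩
  | insert j s _ ih =>
    obtain ⟨ψ, hψ, hψs⟩ := ih
    obtain ⟨φ, hφ, hφj⟩ := h j
    refine ⟨_, (isClopenFor_component hL2 hH hA (x j)).piecewise_mem_symbolBall hφ hψ,
      fun i hi => ?_⟩
    by_cases hij : x i ∈ component A (x j)
    · rw [Set.piecewise_eq_of_mem _ _ _ hij, hφj i hij]
    · rw [Set.piecewise_eq_of_notMem _ _ _ hij]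
      refine hψs i (Finset.mem_of_mem_insert_of_ne hi ?_)
      rintro rfl
      exact hij (mem_component_self A (x i))

lemma exists_mem_symbolBall_of_posSemidef (hL2 : IsSubspaceL2 H μ)
    (hH : ∀ x : X, ∃ f : H, f x ≠ 0) (hA : IsDualAlgebraOfMultipliers A) {x : ι → X} {w : ι → ℂ}
    (hpos : ∀ f : H,
      (pickMatrix (kernelFn (symbols A) (absSqMeasure f μ)) x w).PosSemidef) :
    ∃ φ ∈ symbolBall A, ∀ i, φ (x i) = w i := by
  refine exists_mem_symbolBall_of_forall_finset hL2 hH hA fun s => ?_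
  obtain ⟨φ, hφ, hφw⟩ : ∃ φ ∈ symbolBall A, ∀ i : s, φ (x i) = w i :=
    exists_mem_symbolBall_of_forall_component hL2 hH hA fun j => by
      obtain ⟨φ, hφ, hφw⟩ := exists_mem_symbolBall_of_mem_component hL2 hH hA (x₀ := x j)
        (fun i : {i : s // x i ∈ component A (x j)} => i.2)
        (w := fun i => w i) fun f => (hpos f).submatrix (Subtype.val ∘ Subtype.val)
      exact ⟨φ, hφ, fun i hi => hφw ⟨i, hi⟩⟩
  exact ⟨φ, hφ, fun i hi => hφw ⟨i, hi⟩⟩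

end Interpolation

end PickDual

end

theorem corollaryC_general {X H ι : Type*} [MeasurableSpace X]
    (μ : MeasureTheory.Measure X)
    [NormedAddCommGroup H] [InnerProductSpace ℂ H] [CompleteSpace H] [RKHS ℂ H X ℂ]
    (hL2 : PickDual.IsSubspaceL2 H μ)
    (hH : ∀ x : X, ∃ f : H, f x ≠ 0)
    (A : Subalgebra ℂ (H →L[ℂ] H)) (hA : PickDual.IsDualAlgebraOfMultipliers A)
    (x : ι → X) (w : ι → ℂ) :
    (∃ φ ∈ PickDual.symbols A, (∀ y : X, ‖φ y‖ ≤ 1) ∧ ∀ i, φ (x i) = w i) ↔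
      ∀ f : H, (Matrix.of fun i j : ι =>
        (1 - w i * conj (w j)) *
          PickDual.kernelFn (PickDual.symbols A) (PickDual.absSqMeasure f μ) (x i)
            (x j)).PosSemidef := by
  constructor
  · rintro ⟨φ, hφ, hφ1, hφw⟩ f
    obtain rfl : (fun i => φ (x i)) = w := funext hφw
    exact PickDual.posSemidef_pickMatrix_of_mem_symbolBall hL2 hH hA.subset_multipliers x
      ⟨hφ, hφ1⟩ f
  · intro hpos
    obtain ⟨φ, ⟨hφ, hφ1⟩, hφw⟩ := PickDual.exists_mem_symbolBall_of_posSemidef hL2 hH hA hpos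
    exact ⟨φ, hφ, hφ1, hφw⟩

theorem corollaryC {X H : Type*} [MeasurableSpace X] (μ : MeasureTheory.Measure X)
    [MeasureTheory.SigmaFinite μ]
    [NormedAddCommGroup H] [InnerProductSpace ℂ H] [CompleteSpace H] [RKHS ℂ H X ℂ]
    (hL2 : PickDual.IsSubspaceL2 H μ)
    (hH : ∀ x : X, ∃ f : H, f x ≠ 0)
    (A : Subalgebra ℂ (H →L[ℂ] H)) (hA : PickDual.IsDualAlgebraOfMultipliers A)
    {n : ℕ} (x : Fin n → X) (w : Fin n → ℂ) :
    (∃ φ ∈ PickDual.symbols A, (∀ y : X, ‖φ y‖ ≤ 1) ∧ ∀ i, φ (x i) = w i) ↔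
      ∀ f : H, (Matrix.of fun i j : Fin n =>
        (1 - w i * conj (w j)) *
          PickDual.kernelFn (PickDual.symbols A) (PickDual.absSqMeasure f μ) (x i) (x j)).PosSemidef :=
  corollaryC_general μ hL2 hH A hA x w
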